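/- Let $K$ be a field, $P=K[x_1,\dots,x_n]$, $\prec_m$ a degree-compatible monomial order on $P$ (smaller total degree implies smaller), and $f=(f_1,\dots,f_d)\in P^d$ with every $f_i$ homogeneous. On the module monomials $x^\alpha E_i$ of $P^d$ let $x^\alpha E_i\prec_s x^\beta E_j$ iff $i>j$, or $i=j$ and $x^\alpha\prec_m x^\beta$. **Pairs.** A pair is $p=(u,v)\in P^d\times P$ with $u\cdot f=v$; $\mathrm{lm}(p)=\mathrm{lm}(v)$, $\mathrm{lt}(p)=\mathrm{lt}(v)$, $\mathrm{sig}(p)=\mathrm{lm}(u)$ (leading monomial of $0$ is $0$); $\mathrm{index}(p)=i$ if $\mathrm{sig}(p)=x^\alpha E_i$. It is syzygy if $v=0$. Put $p_1\equiv p_2$ iff $\mathrm{sig}(p_1)=\mathrm{sig}(p_2)$ and $\mathrm{lm}(p_1)=\mathrm{lm}(p_2)$; $p_1\sim p_2$ (similar) iff $\mathrm{lm}(p_1)\mathrm{sig}(p_2)=\mathrm{lm}(p_2)\mathrm{sig}(p_1)$; $p_1\prec_p p_2$ iff $\mathrm{lm}(p_1)\mathrm{sig}(p_2)\prec_s\mathrm{lm}(p_2)\mathrm{sig}(p_1)$.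 A pair $p_1$ is top reducible by $p_2$ if both are non-syzygy, $p_1\prec_p p_2$ and $\mathrm{lm}(p_2)\mid\mathrm{lm}(p_1)$; the reduction replaces $p_1$ by $p_1-\frac{\mathrm{lt}(p_1)}{\mathrm{lt}(p_2)}p_2$. A TRP pair is a non-syzygy pair that is not top reducible by any pair; a TRB pair is a TRP pair whose signature is not properly divisible by the signature of a TRP pair similar to it. A multiplied pair $[m,p]$ consists of a monomial $m$ and a pair $p$, with value $mp$; $p_1$ is top reducible by $[m,p]$ if it is top reducible by $p$ and $\mathrm{lm}(p_1)=\mathrm{lm}(mp)$. The J-pair of two non-similar non-syzygy pairs $p_1,p_2$ is $[\mathrm{lcm}(\mathrm{lm}(p_1),\mathrm{lm}(p_2))/\mathrm{lm}(p),\,p]$, where $p$ is the $\prec_p$-smaller of the two. **Criteria.** Let $DONE$ be a set and $Rules$ a list of pairs. $[m,p]$ meets the Syzygy Criterion if some $p_1\in DONE$ has $i=\mathrm{index}(p)<\mathrm{index}(p_1)$ and $\mathrm{lm}(p_1)E_i\mid\mathrm{sig}(mp)$. It meets the Rewritten Criterion if $Rules$ has an entry whose signature divides $\mathrm{sig}(mp)$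 and the first such entry is not $p$. It passes the F5 criteria if it meets neither. A pair is F5-reducible by $DONE$ if it is top reducible by some $[m,q]$ with $q\in DONE$ that passes the F5 criteria. Put $p_1\prec_{F5}p_2$ iff $\mathrm{index}(p_1)>\mathrm{index}(p_2)$, or the indices are equal and $\deg\mathrm{lm}(p_1)<\deg\mathrm{lm}(p_2)$. **TRB-F5.** Start with $DONE=\emptyset$, $TODO=\{[1,(E_i,f_i)]: 1\le i\le d\}$ and $Rules$ empty, and repeat until $TODO=\emptyset$: (a) as long as $TODO$ contains some $[m,p]$ with $\prec_{F5}$-minimal value that passes the F5 criteria and is not yet of the form $[1,q]$ with $q$ in $Rules$, replace it by $[1,mp]$ and prepend $mp$ to $Rules$; (b) remove from $TODO$ ("select") some $[m,p]$ of smallest signature; if it does not pass the F5 criteria, discard it; (c) otherwise reduce $mp$ by successive F5 reductions by $DONE$ until the result $p'$ is not F5-reducible by $DONE$, and replace $mp$ by $p'$ in $Rules$; (d) unless $p'\equiv mp$ and $p'$ is not one of the $(E_i,f_i)$, add to $TODO$ all J-pairs of $p'$ with elements of $DONE$, and then add $p'$ to $DONE$. Choices that are left open are arbitrary. At any moment of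 a run, a signature is called considered if it is $\prec_s$ the signature of the last selected multiplied pair. **Claim.** At every moment of every run, let $p$ be a non-syzygy pair whose signature is considered. Then: 1. if $p$ is top reducible (by some pair), it is F5-reducible by $DONE$; 2. if $p$ is in $Rules$, it is in $DONE$; 3. if $p$ is TRP, there are a monomial $m_1$ and $p_1\in DONE$ such that $[m_1,p_1]$ passes the F5 criteria and $p\equiv m_1p_1$; 4. if $p$ is TRB, there is $p_1\in DONE$ with $p\equiv p_1$. Consequently TRB-F5 is a regular TRB algorithm: every output $p'$ of the reduction in (c) is not top reducible by any pair, and whenever the algorithm terminates, every TRB pair is equivalent to an element of $DONE$. -/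

import Mathlib

open MvPolynomial

noncomputable section

namespace TRBF5

/-- A homogeneous (degree-compatible) monomial order. -/
def IsHomogeneousOrder {n : ℕ} (ord : MonomialOrder (Fin n)) : Prop :=
  ∀ a b : Fin n →₀ ℕ, a.degree < b.degree → ord.toSyn a < ord.toSyn b

/-- The module monomials `x^mon · E_index` of `K[x_1, …, x_n]^d`. The parameter `ord` is only used to
put the signature order on this type. -/
@[ext]
structure Sig {n : ℕ} (ord : MonomialOrder (Fin n)) (d : ℕ) where
  index : Fin d
  mon : Fin n →₀ ℕ

namespace Sig

variable {n d : ℕ} {ord : MonomialOrder (Fin n)}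

def key (s : Sig ord d) : (Fin d)ᵒᵈ ×ₗ ord.syn :=
  toLex (OrderDual.toDual s.index, ord.toSyn s.mon)

theorem key_injective : Function.Injective (key : Sig ord d → (Fin d)ᵒᵈ ×ₗ ord.syn) := by
  intro s t h
  have h' : (OrderDual.toDual s.index, ord.toSyn s.mon) =
      (OrderDual.toDual t.index, ord.toSyn t.mon) := toLex.injective h
  rw [Prod.mk.injEq] at h'
  exact Sig.ext (OrderDual.toDual.injective h'.1) (ord.toSyn.injective h'.2)

/-- The signature order; `Sig.lt_iff` spells it out. -/
instance : LinearOrder (Sig ord d) := LinearOrder.lift' key key_injective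

theorem lt_iff (s t : Sig ord d) :
    s < t ↔ t.index < s.index ∨ (s.index = t.index ∧ ord.toSyn s.mon < ord.toSyn t.mon) := by
  change key s < key t ↔ _
  simp [key, Prod.Lex.toLex_lt_toLex]

/-- The product of the module monomial `s` by the monomial `x^a`. -/
def mul (a : Fin n →₀ ℕ) (s : Sig ord d) : Sig ord d := ⟨s.index, a + s.mon⟩

/-- Divisibility of module monomials. -/
def Divides (s t : Sig ord d) : Prop := ∃ a, t = mul a s

end Sig

/-- `PAIR`: all `(u, v)` with `u · f = v`, a submodule of `K[x]^d × K[x]`. -/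
def pairModule {K : Type*} [Field K] {n d : ℕ} (f : Fin d → MvPolynomial (Fin n) K) :
    Submodule (MvPolynomial (Fin n) K)
      ((Fin d → MvPolynomial (Fin n) K) × MvPolynomial (Fin n) K) where
  carrier := {p | ∑ i, p.1 i * f i = p.2}
  add_mem' := by
    intro p q hp hq
    simp only [Set.mem_ofPred_eq] at hp hq ⊢
    simp [add_mul, Finset.sum_add_distrib, hp, hq]
  zero_mem' := by simp
  smul_mem' := by
    intro c p hp
    simp only [Set.mem_ofPred_eq] at hp ⊢
    simp [mul_assoc, ← Finset.mul_sum, hp]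

abbrev Pair {K : Type*} [Field K] {n d : ℕ} (f : Fin d → MvPolynomial (Fin n) K) : Type _ :=
  ↥(pairModule f)

/-- Multiplied pairs `[x^a, p]`, the monomial being given by its exponent vector `a`. -/
abbrev MPair {K : Type*} [Field K] {n d : ℕ} (f : Fin d → MvPolynomial (Fin n) K) : Type _ :=
  (Fin n →₀ ℕ) × Pair f

section Pairs

variable {K : Type*} [Field K] {n d : ℕ} (ord : MonomialOrder (Fin n))
  {f : Fin d → MvPolynomial (Fin n) K}

/-- The module part `u` of a pair `(u, v)`. -/
def Pair.u (p : Pair f) : Fin d → MvPolynomial (Fin n) K := p.1.1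

/-- The polynomial part `v` of a pair `(u, v)`. -/
def Pair.v (p : Pair f) : MvPolynomial (Fin n) K := p.1.2

/-- The initial pair `(E_i, f_i)`. -/
def initialPair (f : Fin d → MvPolynomial (Fin n) K) (i : Fin d) : Pair f :=
  ⟨(Pi.single i 1, f i), by
    change ∑ j, (Pi.single i 1 : Fin d → MvPolynomial (Fin n) K) j * f j = f i
    simp [Pi.single_apply]⟩

/-- The module monomials that occur in `u`. -/
def moduleSupport (u : Fin d → MvPolynomial (Fin n) K) : Finset (Sig ord d) :=
  Finset.univ.biUnion fun i => (u i).support.image fun a => ⟨i, a⟩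

/-- `sig(p) = lm(u)`; it is `⊥` (standing for `0`) exactly if `u = 0`. -/
def sig (p : Pair f) : WithBot (Sig ord d) := (moduleSupport ord (Pair.u p)).max

open Classical in
/-- `lm(p) = lm(v)` as an exponent vector; it is `⊥` (standing for `0`) exactly if `v = 0`. -/
def lm (p : Pair f) : WithBot (Fin n →₀ ℕ) :=
  if Pair.v p = 0 then ⊥ else ((ord.degree (Pair.v p) : Fin n →₀ ℕ) : WithBot (Fin n →₀ ℕ))

/-- The leading coefficient of `v`. -/
def lc (p : Pair f) : K := ord.leadingCoeff (Pair.v p)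

/-- The product of a monomial or `0` by a module monomial or `0`. -/
def mulSig (a : WithBot (Fin n →₀ ℕ)) (s : WithBot (Sig ord d)) : WithBot (Sig ord d) :=
  WithBot.map₂ Sig.mul a s

/-- `(u₁, v₁) ≺_p (u₂, v₂)` iff `lm(v₁) lm(u₂) ≺_s lm(v₂) lm(u₁)`. -/
def PairLT (p₁ p₂ : Pair f) : Prop :=
  mulSig ord (lm ord p₁) (sig ord p₂) < mulSig ord (lm ord p₂) (sig ord p₁)

def Equivalent (p₁ p₂ : Pair f) : Prop :=
  sig ord p₁ = sig ord p₂ ∧ lm ord p₁ = lm ord p₂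

def Similar (p₁ p₂ : Pair f) : Prop :=
  mulSig ord (lm ord p₁) (sig ord p₂) = mulSig ord (lm ord p₂) (sig ord p₁)

def IsSyzygy (p : Pair f) : Prop := lm ord p = ⊥

/-- `s ∣ t` for nonzero module monomials `s = sig(p)`, `t = sig(q)`. -/
def SigDivides (s t : WithBot (Sig ord d)) : Prop :=
  ∃ s' t' : Sig ord d, s = s' ∧ t = t' ∧ s'.Divides t'

/-- `p₁` is top reducible by `p₂`. -/
def TopReducibleBy (p₁ p₂ : Pair f) : Prop :=
  ¬ IsSyzygy ord p₁ ∧ ¬ IsSyzygy ord p₂ ∧ PairLT ord p₁ p₂ ∧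
    ∃ a b : Fin n →₀ ℕ, lm ord p₁ = (a : WithBot (Fin n →₀ ℕ)) ∧
      lm ord p₂ = (b : WithBot (Fin n →₀ ℕ)) ∧ b ≤ a

/-- `p` is top reducible by some element of `PAIR`. -/
def TopReducible (p : Pair f) : Prop := ∃ q : Pair f, TopReducibleBy ord p q

/-- Top reductional prime pairs. -/
def IsTRP (p : Pair f) : Prop := ¬ IsSyzygy ord p ∧ ¬ TopReducible ord p

/-- Top reductional basis pairs: TRP pairs whose signature is not properly divisible by the
signature of a TRP pair similar to them. -/
def IsTRB (p : Pair f) : Prop :=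
  IsTRP ord p ∧ ∀ q : Pair f, IsTRP ord q → Similar ord q p →
    SigDivides ord (sig ord q) (sig ord p) → sig ord q = sig ord p

/-- The value `m p` of the multiplied pair `[m, p]`. -/
def value (x : MPair f) : Pair f := (monomial x.1 (1 : K)) • x.2

/-- `p` is top reducible by the multiplied pair `[m, q]`. -/
def TopReducibleByM (p : Pair f) (x : MPair f) : Prop :=
  TopReducibleBy ord p x.2 ∧ lm ord p = lm ord (value x)

/-- The top reduction of `p` by `[m, q]` with `lm(p) = lm(mq)`: `p - (lt(p)/lt(q)) q`. -/
def topReduct (p : Pair f) (x : MPair f) : Pair f :=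
  p - (monomial x.1 (lc ord p / lc ord x.2)) • x.2

/-- `x` is the J-pair of `p₁` and `p₂`; there is none if one of them is syzygy or if they are
similar. -/
def IsJPair (p₁ p₂ : Pair f) (x : MPair f) : Prop :=
  ¬ IsSyzygy ord p₁ ∧ ¬ IsSyzygy ord p₂ ∧ ¬ Similar ord p₁ p₂ ∧
    ((PairLT ord p₁ p₂ ∧ x.2 = p₁) ∨ (PairLT ord p₂ p₁ ∧ x.2 = p₂)) ∧
    x.1 = (ord.degree (Pair.v p₁) ⊔ ord.degree (Pair.v p₂)) - ord.degree (Pair.v x.2)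

/-- `deg(p) = |α|` for `lm(p) = x^α` (and `⊥` if `lm(p) = 0`). -/
def deg (p : Pair f) : WithBot ℕ := (lm ord p).map fun a => a.degree

/-- The order `≺_F5`. -/
def F5LT (p₁ p₂ : Pair f) : Prop :=
  ∃ s₁ s₂ : Sig ord d, sig ord p₁ = s₁ ∧ sig ord p₂ = s₂ ∧
    (s₂.index < s₁.index ∨ (s₁.index = s₂.index ∧ deg ord p₁ < deg ord p₂))

/-! The criteria -/

/-- `[m, p]` meets the Syzygy Criterion with respect to `DONE`. -/
def MeetsSyzygy (DONE : Set (Pair f)) (x : MPair f) : Prop :=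
  ∃ p₁ ∈ DONE, ∃ (s s₁ : Sig ord d) (a : Fin n →₀ ℕ),
    sig ord x.2 = s ∧ sig ord p₁ = s₁ ∧ lm ord p₁ = (a : WithBot (Fin n →₀ ℕ)) ∧
    s.index < s₁.index ∧
    SigDivides ord ((⟨s.index, a⟩ : Sig ord d) : WithBot (Sig ord d)) (sig ord (value x))

open Classical in
/-- `[m, p]` meets the Rewritten Criterion with respect to `Rules`: the first entry of `Rules` whose
signature divides `sig(mp)` exists and differs from `p`. -/
def MeetsRewritten (Rules : List (Pair f)) (x : MPair f) : Prop :=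
  ∃ q, Rules.find? (fun r => decide (SigDivides ord (sig ord r) (sig ord (value x)))) = some q ∧
    x.2 ≠ q

def PassesF5 (DONE : Set (Pair f)) (Rules : List (Pair f)) (x : MPair f) : Prop :=
  ¬ MeetsSyzygy ord DONE x ∧ ¬ MeetsRewritten ord Rules x

/-- `p` is F5 reducible by `[m, q]`. -/
def F5ReducibleBy (DONE : Set (Pair f)) (Rules : List (Pair f)) (p : Pair f) (x : MPair f) :
    Prop :=
  TopReducibleByM ord p x ∧ PassesF5 ord DONE Rules x

/-- `p` is F5 reducible by `DONE`. -/
def F5Reducible (DONE : Set (Pair f)) (Rules : List (Pair f)) (p : Pair f) : Prop :=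
  ∃ x : MPair f, x.2 ∈ DONE ∧ F5ReducibleBy ord DONE Rules p x

end Pairs

/-! The algorithm, as a nondeterministic transition system -/

/-- The point of the program that has been reached: in front of a selection; right after the
selection of a multiplied pair; inside the reduction of the value of the selected multiplied pair,
with its present intermediate result. -/
inductive Phase {K : Type*} [Field K] {n d : ℕ} (f : Fin d → MvPolynomial (Fin n) K) where
  | idle : Phase f
  | selected (x : MPair f) : Phase f
  | reducing (x : MPair f) (q : Pair f) : Phase f

structure State {K : Type*} [Field K] {n d : ℕ} (f : Fin d → MvPolynomial (Fin n) K) where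
  DONE : Set (Pair f)
  TODO : Set (MPair f)
  /-- the Rewrite Rule List, head first -/
  Rules : List (Pair f)
  /-- the last selected multiplied pair -/
  last : Option (MPair f)
  phase : Phase f

section Algorithm

variable {K : Type*} [Field K] {n d : ℕ} (ord : MonomialOrder (Fin n))
  {f : Fin d → MvPolynomial (Fin n) K}

def initialState (f : Fin d → MvPolynomial (Fin n) K) : State f where
  DONE := ∅
  TODO := Set.range fun i => ((0 : Fin n →₀ ℕ), initialPair f i)
  Rules := []
  last := none
  phase := Phase.idle

/-- `[m, p]` has to be replaced by `[1, mp]` before the next selection: it is `≺_F5`-smallest in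
`TODO`, passes the criteria and is not already of the form `[1, q]` with `q` entered in `Rules`. -/
def NeedsRule (S : State f) (x : MPair f) : Prop :=
  x ∈ S.TODO ∧ (∀ y ∈ S.TODO, ¬ F5LT ord (value y) (value x)) ∧
    PassesF5 ord S.DONE S.Rules x ∧ ¬ (x.1 = 0 ∧ x.2 ∈ S.Rules)

/-- `CheckStore` blocks the output `q` of the reduction of `p`. -/
def Blocked (p q : Pair f) : Prop :=
  (¬ ∃ i, q = initialPair f i) ∧ Equivalent ord q p

open Classical in
/-- Replacement of the entry `p` of `Rules` by `q`. -/
def replaceRule (Rules : List (Pair f)) (p q : Pair f) : List (Pair f) :=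
  Rules.map fun r => if r = p then q else r

/-- One step of TRB-F5. -/
inductive Step : State f → State f → Prop
  /-- replace `[m, p]` by `[1, mp]` in `TODO` and prepend `mp` to `Rules` -/
  | rule (S : State f) (x : MPair f) (hS : S.phase = Phase.idle) (hx : NeedsRule ord S x) :
      Step S { S with
        TODO := insert (0, value x) (S.TODO \ {x})
        Rules := value x :: S.Rules }
  /-- select a multiplied pair of smallest signature -/
  | select (S : State f) (x : MPair f) (hS : S.phase = Phase.idle)
      (hrule : ∀ y, ¬ NeedsRule ord S y) (hx : x ∈ S.TODO)
      (hmin : ∀ y ∈ S.TODO, ¬ sig ord (value y) < sig ord (value x)) :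
      Step S { S with
        TODO := S.TODO \ {x}
        last := some x
        phase := Phase.selected x }
  /-- discard a multiplied pair that meets the criteria -/
  | discard (S : State f) (x : MPair f) (hS : S.phase = Phase.selected x)
      (hx : ¬ PassesF5 ord S.DONE S.Rules x) :
      Step S { S with phase := Phase.idle }
  /-- start the reduction of a multiplied pair that passes the criteria -/
  | start (S : State f) (x : MPair f) (hS : S.phase = Phase.selected x)
      (hx : PassesF5 ord S.DONE S.Rules x) :
      Step S { S with phase := Phase.reducing x (value x) }
  /-- perform one F5 reduction by an element of `DONE` -/
  | reduce (S : State f) (x : MPair f) (q : Pair f) (y : MPair f)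
      (hS : S.phase = Phase.reducing x q) (hy : y.2 ∈ S.DONE)
      (hq : F5ReducibleBy ord S.DONE S.Rules q y) :
      Step S { S with phase := Phase.reducing x (topReduct ord q y) }
  /-- the reduction is finished and its result is stored -/
  | store (S : State f) (x : MPair f) (q : Pair f) (hS : S.phase = Phase.reducing x q)
      (hq : ¬ F5Reducible ord S.DONE S.Rules q) (hb : ¬ Blocked ord (value x) q) :
      Step S { S with
        DONE := insert q S.DONE
        TODO := S.TODO ∪ {y | ∃ p ∈ S.DONE, IsJPair ord q p y}
        Rules := replaceRule S.Rules (value x) q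
        phase := Phase.idle }
  /-- the reduction is finished and its result is blocked by `CheckStore` -/
  | block (S : State f) (x : MPair f) (q : Pair f) (hS : S.phase = Phase.reducing x q)
      (hq : ¬ F5Reducible ord S.DONE S.Rules q) (hb : Blocked ord (value x) q) :
      Step S { S with
        Rules := replaceRule S.Rules (value x) q
        phase := Phase.idle }

/-- The states that can occur in a run of TRB-F5 on the input `f`. -/
def Reachable (S : State f) : Prop := Relation.ReflTransGen (Step ord) (initialState f) S

/-- The algorithm stops and outputs `DONE`. -/
def Terminal (S : State f) : Prop := S.phase = Phase.idle ∧ S.TODO = ∅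

/-- The signature of `p` is considered. -/
def Considered (S : State f) (p : Pair f) : Prop :=
  ∃ x, S.last = some x ∧ sig ord p < sig ord (value x)

end Algorithm

/-- TRB-F5 is a regular TRB algorithm: for all homogeneous inputs, every output of its reduction
function is top irreducible by all pairs, and whenever it terminates, every TRB pair is
equivalent to an element of `DONE`. -/
def IsRegularTRB (K : Type*) [Field K] {n : ℕ} (d : ℕ) (ord : MonomialOrder (Fin n)) : Prop :=
  ∀ f : Fin d → MvPolynomial (Fin n) K, (∀ i, ∃ k, (f i).IsHomogeneous k) →
    (∀ (S : State f) (x : MPair f) (q : Pair f), Reachable ord S →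
      S.phase = Phase.reducing x q → ¬ F5Reducible ord S.DONE S.Rules q →
        ¬ TopReducible ord q) ∧
    (∀ S : State f, Reachable ord S → Terminal S →
      ∀ p : Pair f, IsTRB ord p → ∃ p₁ ∈ S.DONE, Equivalent ord p p₁)

end TRBF5

end

/-!
The rule list assigns to every module monomial `s` that is not the signature of a syzygy a unique
responsible pair `r`, the first rule whose signature divides `s`. Let `m r` be the multiple of `r`
with signature `s`. If `m r` were top reducible, it would be so by a TRP pair of smaller signature,
hence, by induction, by a multiple of some `q` in `DONE`. The J-pair of `r` and `q` is then a
multiple of `r` whose signature divides `s`, so `r` is responsible for that signature as well and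
neither criterion can have discarded the J-pair: it would still be waiting, although its signature
is at most `s`. Thus `m r` is TRP. As TRP pairs of the same signature have the same leading
monomial, multiples of elements of `DONE` that pass the criteria represent all TRP pairs whose
signatures have been dealt with, and they F5-reduce whatever is top reducible.

Homogeneity and the degree-compatible order make `≺_F5` a coarsening of the signature order on
`TODO`. So rules are entered by increasing index and degree, no rule is shadowed by a later one, and
each selected multiplied pair that passes the criteria already is a rule.
-/

namespace TRBF5

namespace Sig

variable {n d : ℕ} {ord : MonomialOrder (Fin n)}

instance : WellFoundedLT (Sig ord d) :=
  ⟨InvImage.wf (key : Sig ord d → (Fin d)ᵒᵈ ×ₗ ord.syn) wellFounded_lt⟩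

@[simp] theorem mul_index (a : Fin n →₀ ℕ) (s : Sig ord d) : (mul a s).index = s.index := rfl

@[simp] theorem mul_mon (a : Fin n →₀ ℕ) (s : Sig ord d) : (mul a s).mon = a + s.mon := rfl

theorem mul_mul (a b : Fin n →₀ ℕ) (s : Sig ord d) : mul a (mul b s) = mul (a + b) s := by
  ext1 <;> simp [add_assoc]

theorem mul_lt_mul_iff (a : Fin n →₀ ℕ) {s t : Sig ord d} : mul a s < mul a t ↔ s < t := by
  simp [lt_iff]

theorem le_mul (a : Fin n →₀ ℕ) (s : Sig ord d) : s ≤ mul a s := by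
  rw [← not_lt, lt_iff]
  simp

theorem Divides.le {s t : Sig ord d} (h : s.Divides t) : s ≤ t := by
  obtain ⟨a, rfl⟩ := h
  exact le_mul a s

theorem Divides.trans {s t r : Sig ord d} (h : s.Divides t) (h' : t.Divides r) : s.Divides r := by
  obtain ⟨a, rfl⟩ := h
  obtain ⟨b, rfl⟩ := h'
  exact ⟨b + a, mul_mul b a s⟩

/-- The module monomial `E_i`. -/
def basis (i : Fin d) : Sig ord d := ⟨i, 0⟩

theorem basis_divides (s : Sig ord d) : (basis s.index : Sig ord d).Divides s :=
  ⟨s.mon, by ext1 <;> simp [basis]⟩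

/-- The index and the degree of a module monomial, ordered as in `≺_F5`. For a degree-compatible
order it is a coarsening of the signature order. -/
noncomputable def grade (s : Sig ord d) : (Fin d)ᵒᵈ ×ₗ ℕ :=
  toLex (OrderDual.toDual s.index, s.mon.degree)

theorem grade_monotone (hord : IsHomogeneousOrder ord) :
    Monotone (grade : Sig ord d → (Fin d)ᵒᵈ ×ₗ ℕ) := by
  intro s t h
  rw [← not_lt, grade, grade, Prod.Lex.toLex_lt_toLex]
  rintro (hi | ⟨hi, hlt⟩)
  · exact h.not_gt ((lt_iff t s).2 (.inl hi))
  · exact h.not_gt ((lt_iff t s).2 (.inr ⟨OrderDual.toDual.injective hi, hord _ _ hlt⟩))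

theorem Divides.eq_of_grade_le {s t : Sig ord d} (h : s.Divides t) (hle : t.grade ≤ s.grade) :
    s = t := by
  obtain ⟨a, rfl⟩ := h
  have ha : a = 0 := by
    simpa [grade, Prod.Lex.toLex_le_toLex, Finsupp.degree_eq_zero_iff] using hle
  ext1 <;> simp [ha]

end Sig

section Signatures

variable {n d : ℕ} {ord : MonomialOrder (Fin n)} {s t r : WithBot (Sig ord d)}

/-- The grade of a signature, which may be `⊥` (standing for `0`). -/
noncomputable def sigGrade (s : WithBot (Sig ord d)) : WithBot ((Fin d)ᵒᵈ ×ₗ ℕ) := s.map Sig.grade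

theorem sigGrade_monotone (hord : IsHomogeneousOrder ord) :
    Monotone (sigGrade : WithBot (Sig ord d) → WithBot ((Fin d)ᵒᵈ ×ₗ ℕ)) :=
  (Sig.grade_monotone hord).withBot_map

@[simp] theorem mulSig_bot (a : WithBot (Fin n →₀ ℕ)) :
    mulSig ord a (⊥ : WithBot (Sig ord d)) = ⊥ :=
  WithBot.map₂_bot_right _ a

theorem mulSig_coe_coe (a : Fin n →₀ ℕ) (s : Sig ord d) :
    mulSig ord a (s : WithBot (Sig ord d)) = (Sig.mul a s : Sig ord d) := rfl

theorem mulSig_mulSig (a b : WithBot (Fin n →₀ ℕ)) (s : WithBot (Sig ord d)) :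
    mulSig ord a (mulSig ord b s) = mulSig ord (a + b) s := by
  cases a <;> cases b <;> cases s <;> first | rfl | exact congrArg _ (Sig.mul_mul _ _ _)

theorem mulSig_lt_mulSig_iff {a : WithBot (Fin n →₀ ℕ)} (ha : a ≠ ⊥) :
    mulSig ord a s < mulSig ord a t ↔ s < t := by
  lift a to Fin n →₀ ℕ using ha
  cases s <;> cases t <;>
    simp only [mulSig_coe_coe, mulSig_bot, Sig.mul_lt_mul_iff, WithBot.coe_lt_coe,
      WithBot.bot_lt_coe, not_lt_bot, lt_irrefl]

theorem le_mulSig (a : Fin n →₀ ℕ) (s : WithBot (Sig ord d)) : s ≤ mulSig ord a s := by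
  cases s
  · simp
  · exact WithBot.coe_le_coe.2 (Sig.le_mul _ _)

theorem lt_mulSig {a : Fin n →₀ ℕ} (ha : a ≠ 0) (hs : s ≠ ⊥) : s < mulSig ord a s := by
  refine lt_of_le_of_ne (le_mulSig a s) fun h => ha ?_
  lift s to Sig ord d using hs
  have hmon : s.mon = a + s.mon := congrArg Sig.mon (WithBot.coe_injective h)
  simpa using hmon

theorem sigDivides_refl (hs : s ≠ ⊥) : SigDivides ord s s := by
  lift s to Sig ord d using hs
  exact ⟨s, s, rfl, rfl, 0, by ext1 <;> simp⟩

theorem sigDivides_mulSig (a : Fin n →₀ ℕ) (hs : s ≠ ⊥) : SigDivides ord s (mulSig ord a s) := by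
  lift s to Sig ord d using hs
  exact ⟨s, _, rfl, rfl, a, rfl⟩

theorem SigDivides.trans (h : SigDivides ord s t) (h' : SigDivides ord t r) :
    SigDivides ord s r := by
  obtain ⟨s, t, rfl, rfl, h⟩ := h
  obtain ⟨t', r, ht, rfl, h'⟩ := h'
  obtain rfl := WithBot.coe_injective ht
  exact ⟨s, r, rfl, rfl, h.trans h'⟩

theorem SigDivides.ne_bot_right (h : SigDivides ord s t) : t ≠ ⊥ := by
  obtain ⟨-, t, -, rfl, -⟩ := h
  exact WithBot.coe_ne_bot

theorem SigDivides.exists_mulSig (h : SigDivides ord s t) :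
    ∃ a : Fin n →₀ ℕ, mulSig ord a s = t := by
  obtain ⟨s, t, rfl, rfl, a, rfl⟩ := h
  exact ⟨a, rfl⟩

theorem SigDivides.le (h : SigDivides ord s t) : s ≤ t := by
  obtain ⟨s, t, rfl, rfl, h⟩ := h
  exact WithBot.coe_le_coe.2 h.le

theorem SigDivides.eq_of_sigGrade_le (h : SigDivides ord s t) (hle : sigGrade t ≤ sigGrade s) :
    s = t := by
  obtain ⟨s, t, rfl, rfl, h⟩ := h
  exact congrArg _ (h.eq_of_grade_le (WithBot.coe_le_coe.1 hle))

theorem exists_basis_sigDivides (hs : s ≠ ⊥) :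
    ∃ i, SigDivides ord ((Sig.basis i : Sig ord d) : WithBot (Sig ord d)) s := by
  lift s to Sig ord d using hs
  exact ⟨s.index, _, s, rfl, rfl, s.basis_divides⟩

theorem SigDivides.eq_basis {i : Fin d}
    (h : SigDivides ord s ((Sig.basis i : Sig ord d) : WithBot (Sig ord d))) :
    s = (Sig.basis i : Sig ord d) := by
  refine h.eq_of_sigGrade_le ?_
  obtain ⟨s, t, rfl, ht, a, rfl⟩ := h
  obtain rfl : i = s.index := congrArg Sig.index (WithBot.coe_injective ht)
  exact WithBot.coe_le_coe.2 (by simp [Sig.grade, Sig.basis, Prod.Lex.toLex_le_toLex])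

end Signatures

section Pairs

variable {K : Type*} [Field K] {n d : ℕ} {ord : MonomialOrder (Fin n)}
  {f : Fin d → MvPolynomial (Fin n) K} {p q : Pair f}

/-- The coefficient of the module monomial `s` in `u`, for a pair `(u, v)`. -/
def ucoeff (s : Sig ord d) (p : Pair f) : K := coeff s.mon (Pair.u p s.index)

theorem ucoeff_sub (s : Sig ord d) (p q : Pair f) :
    ucoeff s (p - q) = ucoeff s p - ucoeff s q :=
  coeff_sub _ _ _ _

theorem ucoeff_smul (s : Sig ord d) (g : MvPolynomial (Fin n) K) (p : Pair f) :
    ucoeff s (g • p) = coeff s.mon (g * Pair.u p s.index) := rfl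

theorem ucoeff_C_smul (s : Sig ord d) (c : K) (p : Pair f) :
    ucoeff s ((C c : MvPolynomial (Fin n) K) • p) = c * ucoeff s p :=
  coeff_C_mul _ _ _

theorem ucoeff_mul_monomial_smul (m : Fin n →₀ ℕ) (c : K) (s : Sig ord d) (p : Pair f) :
    ucoeff (Sig.mul m s) (monomial m c • p) = c * ucoeff s p :=
  coeff_monomial_mul _ _ _ _

theorem exists_eq_mul_of_ucoeff_monomial_smul_ne_zero {m : Fin n →₀ ℕ} {c : K} {t : Sig ord d}
    (h : ucoeff t (monomial m c • p) ≠ 0) :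
    ∃ s, t = Sig.mul m s ∧ ucoeff s p ≠ 0 := by
  have hle : m ≤ t.mon := by
    by_contra hle
    exact h (by rw [ucoeff_smul, coeff_monomial_mul', if_neg hle])
  have ht : t = Sig.mul m ⟨t.index, t.mon - m⟩ := by
    ext1 <;> simp [add_tsub_cancel_of_le hle]
  rw [ht, ucoeff_mul_monomial_smul] at h
  exact ⟨_, ht, right_ne_zero_of_mul h⟩

theorem v_sub (p q : Pair f) : Pair.v (p - q) = Pair.v p - Pair.v q := rfl

theorem v_smul (g : MvPolynomial (Fin n) K) (p : Pair f) : Pair.v (g • p) = g * Pair.v p := rfl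

theorem mem_moduleSupport (s : Sig ord d) :
    s ∈ moduleSupport ord (Pair.u p) ↔ ucoeff s p ≠ 0 := by
  simp only [moduleSupport, Finset.mem_biUnion, Finset.mem_univ, true_and, Finset.mem_image,
    mem_support_iff, ucoeff]
  constructor
  · rintro ⟨i, a, h, rfl⟩
    exact h
  · exact fun h => ⟨s.index, s.mon, h, rfl⟩

theorem sig_le_iff {t : WithBot (Sig ord d)} :
    sig ord p ≤ t ↔ ∀ s : Sig ord d, ucoeff s p ≠ 0 → (s : WithBot (Sig ord d)) ≤ t := by
  simp only [sig, Finset.max_le_iff, mem_moduleSupport]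

theorem le_sig_of_ucoeff_ne_zero {s : Sig ord d} (h : ucoeff s p ≠ 0) : s ≤ sig ord p :=
  Finset.le_max ((mem_moduleSupport s).2 h)

theorem ucoeff_eq_zero_of_sig_lt {s : Sig ord d} (h : sig ord p < s) : ucoeff s p = 0 :=
  by_contra fun h0 => h.not_ge (le_sig_of_ucoeff_ne_zero h0)

theorem ucoeff_ne_zero_of_sig_eq {s : Sig ord d} (h : sig ord p = s) : ucoeff s p ≠ 0 :=
  (mem_moduleSupport s).1 (Finset.mem_of_max h)

theorem sig_monomial_smul (m : Fin n →₀ ℕ) {c : K} (hc : c ≠ 0) (p : Pair f) :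
    sig ord (monomial m c • p) = mulSig ord m (sig ord p) := by
  apply le_antisymm
  · refine sig_le_iff.2 fun t ht => ?_
    obtain ⟨s, rfl, hs⟩ := exists_eq_mul_of_ucoeff_monomial_smul_ne_zero ht
    rw [← mulSig_coe_coe, ← not_lt, mulSig_lt_mulSig_iff WithBot.coe_ne_bot, not_lt]
    exact le_sig_of_ucoeff_ne_zero hs
  · cases hs : sig ord p with
    | bot => simp
    | coe s =>
      refine le_sig_of_ucoeff_ne_zero ?_
      rw [ucoeff_mul_monomial_smul]
      exact mul_ne_zero hc (ucoeff_ne_zero_of_sig_eq hs)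

theorem sig_value (x : MPair f) : sig ord (value x) = mulSig ord x.1 (sig ord x.2) :=
  sig_monomial_smul x.1 one_ne_zero x.2

theorem sig_le_sig_value (x : MPair f) : sig ord x.2 ≤ sig ord (value x) :=
  (le_mulSig _ _).trans_eq (sig_value x).symm

theorem sigDivides_sig_value {x : MPair f} (h : sig ord x.2 ≠ ⊥) :
    SigDivides ord (sig ord x.2) (sig ord (value x)) := by
  rw [sig_value]
  exact sigDivides_mulSig x.1 h

theorem sig_sub_of_lt (h : sig ord q < sig ord p) : sig ord (p - q) = sig ord p := by
  apply le_antisymm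
  · refine sig_le_iff.2 fun s hs => ?_
    by_contra! hlt
    rw [ucoeff_sub, ucoeff_eq_zero_of_sig_lt hlt, ucoeff_eq_zero_of_sig_lt (h.trans hlt)] at hs
    exact hs (sub_zero 0)
  · obtain ⟨s, hs⟩ := WithBot.ne_bot_iff_exists.1 h.ne_bot
    rw [← hs] at h ⊢
    refine le_sig_of_ucoeff_ne_zero ?_
    rw [ucoeff_sub, ucoeff_eq_zero_of_sig_lt h, sub_zero]
    exact ucoeff_ne_zero_of_sig_eq hs.symm

theorem exists_sig_sub_C_smul_lt (h : sig ord q = sig ord p) (hp : sig ord p ≠ ⊥) :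
    ∃ c : K, sig ord (p - (C c : MvPolynomial (Fin n) K) • q) < sig ord p := by
  obtain ⟨s, hs⟩ := WithBot.ne_bot_iff_exists.1 hp
  refine ⟨ucoeff s p / ucoeff s q, lt_of_le_of_ne (sig_le_iff.2 fun t ht => ?_) fun h_eq => ?_⟩
  · by_contra! hlt
    rw [ucoeff_sub, ucoeff_C_smul, ucoeff_eq_zero_of_sig_lt hlt,
      ucoeff_eq_zero_of_sig_lt (h.trans_lt hlt)] at ht
    simp at ht
  · refine ucoeff_ne_zero_of_sig_eq (h_eq.trans hs.symm) ?_
    rw [ucoeff_sub, ucoeff_C_smul,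
      div_mul_cancel₀ _ (ucoeff_ne_zero_of_sig_eq (h.trans hs.symm)), sub_self]

theorem sig_initialPair (i : Fin d) : sig ord (initialPair f i) = (Sig.basis i : Sig ord d) := by
  apply le_antisymm
  · refine sig_le_iff.2 fun s hs => ?_
    obtain ⟨j, a⟩ := s
    have hs' : coeff a ((Pi.single i 1 : Fin d → MvPolynomial (Fin n) K) j) ≠ 0 := hs
    obtain rfl : j = i := by
      by_contra hj
      simp [hj] at hs'
    obtain rfl : a = 0 := by
      by_contra ha
      simp [coeff_one, Ne.symm ha] at hs'
    exact le_rfl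
  · refine le_sig_of_ucoeff_ne_zero ?_
    simp [ucoeff, Sig.basis, initialPair, Pair.u]

theorem lm_eq_withBotDegree (p : Pair f) : lm ord p = ord.withBotDegree (Pair.v p) := by
  classical simp only [lm, MonomialOrder.withBotDegree_eq]

theorem isSyzygy_iff : IsSyzygy ord p ↔ Pair.v p = 0 := by
  rw [IsSyzygy, lm_eq_withBotDegree, MonomialOrder.withBotDegree_eq_bot_iff]

theorem lm_eq_coe_degree (hp : ¬ IsSyzygy ord p) : lm ord p = ord.degree (Pair.v p) :=
  if_neg (isSyzygy_iff.not.1 hp)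

theorem lm_monomial_smul (m : Fin n →₀ ℕ) {c : K} (hc : c ≠ 0) (p : Pair f) :
    lm ord (monomial m c • p) = m + lm ord p := by
  classical simp only [lm_eq_withBotDegree, v_smul, MonomialOrder.withBotDegree_mul,
    MonomialOrder.withBotDegree_monomial, if_neg hc]

theorem lm_value (x : MPair f) : lm ord (value x) = x.1 + lm ord x.2 :=
  lm_monomial_smul x.1 one_ne_zero x.2

@[simp] theorem value_zero (p : Pair f) : value ((0 : Fin n →₀ ℕ), p) = p :=
  one_smul (MvPolynomial (Fin n) K) p

theorem isSyzygy_value_iff {x : MPair f} : IsSyzygy ord (value x) ↔ IsSyzygy ord x.2 := by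
  simp [IsSyzygy, lm_value]

theorem sig_ne_bot (hp : ¬ IsSyzygy ord p) : sig ord p ≠ ⊥ := by
  contrapose! hp
  have hu : ∀ i, Pair.u p i = 0 := fun i => ext _ _ fun a =>
    ucoeff_eq_zero_of_sig_lt (s := (⟨i, a⟩ : Sig ord d)) (hp ▸ WithBot.bot_lt_coe _)
  have hv : ∑ i, Pair.u p i * f i = Pair.v p := p.2
  rw [isSyzygy_iff, ← hv]
  exact Finset.sum_eq_zero fun i _ => by rw [hu, MulZeroClass.zero_mul]

end Pairs

section TopReducibility

variable {K : Type*} [Field K] {n d : ℕ} {ord : MonomialOrder (Fin n)}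
  {f : Fin d → MvPolynomial (Fin n) K} {p q : Pair f} {x : MPair f}

theorem pairLT_iff_sig_value_lt {m m' : Fin n →₀ ℕ} (hp : ¬ IsSyzygy ord p)
    (h : lm ord (value (m, p)) = lm ord (value (m', q))) :
    PairLT ord p q ↔ sig ord (value (m', q)) < sig ord (value (m, p)) := by
  simp only [lm_value, sig_value] at h ⊢
  calc PairLT ord p q
      ↔ mulSig ord (m' + lm ord p) (sig ord q) < mulSig ord (m' + lm ord q) (sig ord p) := by
        rw [PairLT, ← mulSig_lt_mulSig_iff (WithBot.coe_ne_bot (a := m')), mulSig_mulSig,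
          mulSig_mulSig]
    _ ↔ mulSig ord (lm ord p) (mulSig ord m' (sig ord q)) <
          mulSig ord (lm ord p) (mulSig ord m (sig ord p)) := by
        rw [← h, mulSig_mulSig, mulSig_mulSig, add_comm (lm ord p), add_comm (lm ord p)]
    _ ↔ mulSig ord m' (sig ord q) < mulSig ord m (sig ord p) := mulSig_lt_mulSig_iff hp

theorem topReducibleByM_iff :
    TopReducibleByM ord p x ↔
      ¬ IsSyzygy ord p ∧ lm ord p = lm ord (value x) ∧ sig ord (value x) < sig ord p := by
  have pairLT_iff (hp : ¬ IsSyzygy ord p) (hlm : lm ord p = lm ord (value x)) :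
      PairLT ord p x.2 ↔ sig ord (value x) < sig ord p := by
    have := pairLT_iff_sig_value_lt (m := 0) (m' := x.1) (q := x.2) hp (by rwa [value_zero])
    rwa [value_zero] at this
  constructor
  · rintro ⟨⟨hp, -, hlt, -⟩, hlm⟩
    exact ⟨hp, hlm, (pairLT_iff hp hlm).1 hlt⟩
  · rintro ⟨hp, hlm, hlt⟩
    have hx : ¬ IsSyzygy ord x.2 := by
      rwa [← isSyzygy_value_iff, IsSyzygy, ← hlm]
    refine ⟨⟨hp, hx, (pairLT_iff hp hlm).2 hlt, _, _, lm_eq_coe_degree hp, lm_eq_coe_degree hx,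
      ?_⟩, hlm⟩
    rw [lm_value, lm_eq_coe_degree hp, lm_eq_coe_degree hx] at hlm
    exact le_add_self.trans_eq (WithBot.coe_injective hlm).symm

theorem topReducibleBy_iff_exists :
    TopReducibleBy ord p q ↔ ∃ m, TopReducibleByM ord p (m, q) := by
  refine ⟨fun h => ?_, fun ⟨m, h⟩ => h.1⟩
  obtain ⟨a, b, ha, hb, hle⟩ := h.2.2.2
  refine ⟨a - b, h, ?_⟩
  rw [lm_value, ha, hb, ← WithBot.coe_add, tsub_add_cancel_of_le hle]

theorem topReducible_iff_exists :
    TopReducible ord p ↔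
      ¬ IsSyzygy ord p ∧ ∃ q : Pair f, lm ord p = lm ord q ∧ sig ord q < sig ord p := by
  simp only [TopReducible, topReducibleBy_iff_exists, topReducibleByM_iff]
  constructor
  · rintro ⟨q, m, hp, h⟩
    exact ⟨hp, _, h⟩
  · rintro ⟨hp, q, h⟩
    exact ⟨q, 0, hp, by rwa [value_zero]⟩

theorem TopReducibleByM.topReducible (h : TopReducibleByM ord p x) : TopReducible ord p :=
  ⟨x.2, h.1⟩

theorem Equivalent.topReducible (h : Equivalent ord p q) (hp : TopReducible ord p) :
    TopReducible ord q := by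
  rw [topReducible_iff_exists, IsSyzygy] at hp ⊢
  rwa [h.1, h.2] at hp

theorem exists_isTRP (hp : ¬ IsSyzygy ord p) :
    ∃ r : Pair f, IsTRP ord r ∧ lm ord r = lm ord p ∧ sig ord r ≤ sig ord p := by
  obtain ⟨r, hr, hmin⟩ := exists_minimalFor_of_wellFoundedLT
    (fun q : Pair f => lm ord q = lm ord p) (sig ord) ⟨p, rfl⟩
  refine ⟨r, ⟨by rwa [IsSyzygy, hr], fun h => ?_⟩, hr, (le_total _ _).elim id fun h => hmin rfl h⟩
  obtain ⟨-, q, hq, hlt⟩ := topReducible_iff_exists.1 h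
  exact hlt.not_ge (hmin (hq.symm.trans hr) hlt.le)

theorem TopReducible.exists_isTRP (h : TopReducible ord p) :
    ∃ r : Pair f, IsTRP ord r ∧ lm ord r = lm ord p ∧ sig ord r < sig ord p := by
  obtain ⟨hp, q, hlm, hlt⟩ := topReducible_iff_exists.1 h
  obtain ⟨r, hr, hr_lm, hr_sig⟩ := TRBF5.exists_isTRP (p := q) (by rwa [IsSyzygy, ← hlm])
  exact ⟨r, hr, hr_lm.trans hlm.symm, hr_sig.trans_lt hlt⟩

open scoped MonomialOrder in
theorem lm_sub_C_smul (h : lm ord q ≺'[ord] lm ord p) (c : K) :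
    lm ord (p - (C c : MvPolynomial (Fin n) K) • q) = lm ord p := by
  simp only [lm_eq_withBotDegree] at h ⊢
  rw [v_sub, v_smul, sub_eq_add_neg]
  refine MonomialOrder.withBotDegree_add_of_lt (lt_of_le_of_lt ?_ h)
  rw [MonomialOrder.withBotDegree_neg, MonomialOrder.withBotDegree_mul]
  rcases eq_or_ne c 0 with rfl | hc
  · simp
  · classical simp [MonomialOrder.withBotDegree_C, hc]

open scoped MonomialOrder in
/-- The difference `p - c q` with the signatures cancelling is a top reducer of `p`. -/
theorem topReducible_of_sig_eq (hsig : sig ord q = sig ord p) (hlm : lm ord q ≺'[ord] lm ord p) :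
    TopReducible ord p := by
  have hp : ¬ IsSyzygy ord p := fun hp => by
    rw [hp] at hlm
    exact not_lt_bot hlm
  obtain ⟨c, hc⟩ := exists_sig_sub_C_smul_lt hsig (sig_ne_bot hp)
  exact topReducible_iff_exists.2 ⟨hp, _, (lm_sub_C_smul hlm c).symm, hc⟩

theorem IsTRP.lm_eq (hp : IsTRP ord p) (hq : IsTRP ord q) (h : sig ord p = sig ord q) :
    lm ord p = lm ord q := by
  apply ord.toWithBotSyn.injective
  rcases lt_trichotomy (ord.toWithBotSyn (lm ord p)) (ord.toWithBotSyn (lm ord q))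
    with hlt | heq | hgt
  · exact absurd (topReducible_of_sig_eq h hlt) hq.2
  · exact heq
  · exact absurd (topReducible_of_sig_eq h.symm hgt) hp.2

/-- `s` is the signature of a syzygy pair. -/
def IsSyzygySig (f : Fin d → MvPolynomial (Fin n) K) (s : WithBot (Sig ord d)) : Prop :=
  ∃ z : Pair f, sig ord z = s ∧ IsSyzygy ord z

theorem IsTRP.not_isSyzygySig (hp : IsTRP ord p) : ¬ IsSyzygySig f (sig ord p) := by
  rintro ⟨z, hz, hz'⟩
  refine hp.2 (topReducible_of_sig_eq hz ?_)
  rw [hz', MonomialOrder.toWithBotSyn_apply_bot, MonomialOrder.bot_lt_toWithBotSyn_apply_iff]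
  exact bot_lt_iff_ne_bot.2 hp.1

theorem IsSyzygySig.of_sigDivides {s t : WithBot (Sig ord d)} (hs : IsSyzygySig f s)
    (h : SigDivides ord s t) : IsSyzygySig f t := by
  obtain ⟨a, rfl⟩ := h.exists_mulSig
  obtain ⟨z, rfl, hz⟩ := hs
  exact ⟨value (a, z), sig_value (a, z), isSyzygy_value_iff.2 hz⟩

end TopReducibility

section Syzygies

variable {K : Type*} [Field K] {n d : ℕ} {ord : MonomialOrder (Fin n)}
  {f : Fin d → MvPolynomial (Fin n) K} {p : Pair f}

theorem sig_smul_initialPair {g : MvPolynomial (Fin n) K} (hg : g ≠ 0) (i : Fin d) :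
    sig ord (g • initialPair f i) = (⟨i, ord.degree g⟩ : Sig ord d) := by
  have ucoeff_eq (s : Sig ord d) : ucoeff s (g • initialPair f i) =
      coeff s.mon (g * (Pi.single i 1 : Fin d → MvPolynomial (Fin n) K) s.index) := rfl
  apply le_antisymm
  · refine sig_le_iff.2 fun s hs => WithBot.coe_le_coe.2 ?_
    obtain ⟨j, a⟩ := s
    rw [ucoeff_eq] at hs
    obtain rfl : j = i := by
      by_contra hj
      simp [hj] at hs
    rw [← not_lt, Sig.lt_iff]
    simpa using ord.le_degree (mem_support_iff.2 (by simpa using hs))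
  · refine le_sig_of_ucoeff_ne_zero ?_
    rw [ucoeff_eq]
    simpa [MonomialOrder.leadingCoeff] using ord.leadingCoeff_ne_zero_iff.2 hg

theorem sig_smul_lt {t : Sig ord d} (hp : sig ord p = t) {i : Fin d} (h : i < t.index)
    (a : Fin n →₀ ℕ) (g : MvPolynomial (Fin n) K) :
    sig ord (g • p) < (⟨i, a⟩ : Sig ord d) := by
  cases hr : sig ord (g • p) with
  | bot => exact WithBot.bot_lt_coe _
  | coe r =>
    have hu : Pair.u p r.index ≠ 0 := fun hu => ucoeff_ne_zero_of_sig_eq hr (by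
      rw [ucoeff_smul, hu, MulZeroClass.mul_zero, coeff_zero])
    obtain ⟨b, hb⟩ := exists_coeff_ne_zero hu
    have hle : (⟨r.index, b⟩ : Sig ord d) ≤ t :=
      WithBot.coe_le_coe.1 ((le_sig_of_ucoeff_ne_zero (s := ⟨r.index, b⟩) hb).trans_eq hp)
    have hindex : t.index ≤ r.index := not_lt.1 fun hlt =>
      hle.not_gt ((Sig.lt_iff _ _).2 (.inl hlt))
    exact WithBot.coe_lt_coe.2 ((Sig.lt_iff _ _).2 (.inl (h.trans_le hindex)))

/-- The principal syzygy `v E_i - f_i u` of a pair `(u, v)` has signature `lm(v) E_i` if `i` is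
smaller than the index of the pair. -/
theorem MeetsSyzygy.isSyzygySig {D : Set (Pair f)} {x : MPair f} (h : MeetsSyzygy ord D x) :
    IsSyzygySig f (sig ord (value x)) := by
  obtain ⟨p, -, s, t, a, -, hp_sig, hp_lm, hlt, hdvd⟩ := h
  have hp : ¬ IsSyzygy ord p := by simp [IsSyzygy, hp_lm]
  rw [lm_eq_coe_degree hp, WithBot.coe_inj] at hp_lm
  refine IsSyzygySig.of_sigDivides
    ⟨Pair.v p • initialPair f s.index - f s.index • p, ?_, ?_⟩ hdvd
  · rw [← hp_lm, ← sig_smul_initialPair (isSyzygy_iff.not.1 hp) s.index]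
    refine sig_sub_of_lt ?_
    rw [sig_smul_initialPair (isSyzygy_iff.not.1 hp)]
    exact sig_smul_lt hp_sig hlt _ _
  · rw [isSyzygy_iff, v_sub, v_smul, v_smul, mul_comm]
    exact sub_self _

end Syzygies

section Reductions

variable {K : Type*} [Field K] {n d : ℕ} {ord : MonomialOrder (Fin n)}
  {f : Fin d → MvPolynomial (Fin n) K} {p q : Pair f} {x y : MPair f}

theorem lc_ne_zero (hp : ¬ IsSyzygy ord p) : lc ord p ≠ 0 :=
  ord.leadingCoeff_ne_zero_iff.2 (isSyzygy_iff.not.1 hp)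

theorem sig_topReduct (h : TopReducibleByM ord p x) :
    sig ord (topReduct ord p x) = sig ord p := by
  have hlt := (topReducibleByM_iff.1 h).2.2
  rw [sig_value] at hlt
  refine sig_sub_of_lt ?_
  rwa [sig_monomial_smul _ (div_ne_zero (lc_ne_zero h.1.1) (lc_ne_zero h.1.2.1))]

theorem PairLT.topReducibleBy_value (h : PairLT ord p q) (hp : ¬ IsSyzygy ord p)
    (hq : ¬ IsSyzygy ord q) {m : Fin n →₀ ℕ}
    (hm : m = (ord.degree (Pair.v p) ⊔ ord.degree (Pair.v q)) - ord.degree (Pair.v p)) :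
    TopReducibleBy ord (value (m, p)) q := by
  set a := ord.degree (Pair.v p)
  set b := ord.degree (Pair.v q)
  have hlm : lm ord (value (m, p)) = lm ord (value ((a ⊔ b) - b, q)) := by
    rw [lm_value, lm_value, lm_eq_coe_degree hp, lm_eq_coe_degree hq, hm, ← WithBot.coe_add,
      ← WithBot.coe_add, tsub_add_cancel_of_le le_sup_left, tsub_add_cancel_of_le le_sup_right]
  exact topReducibleBy_iff_exists.2 ⟨_, topReducibleByM_iff.2
    ⟨isSyzygy_value_iff.not.2 hp, hlm, (pairLT_iff_sig_value_lt hp hlm).1 h⟩⟩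

theorem IsJPair.symm (h : IsJPair ord p q y) : IsJPair ord q p y := by
  obtain ⟨hp, hq, hsim, hlt, hy⟩ := h
  exact ⟨hq, hp, fun h => hsim h.symm, hlt.symm, by rw [hy, sup_comm]⟩

theorem IsJPair.topReducibleBy_or (h : IsJPair ord p q y) :
    (y.2 = p ∧ TopReducibleBy ord (value y) q) ∨ (y.2 = q ∧ TopReducibleBy ord (value y) p) := by
  obtain ⟨m, r⟩ := y
  obtain ⟨hp, hq, -, ⟨hlt, rfl : r = p⟩ | ⟨hlt, rfl : r = q⟩, hm⟩ := h
  · exact .inl ⟨rfl, hlt.topReducibleBy_value hp hq hm⟩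
  · exact .inr ⟨rfl, hlt.topReducibleBy_value hq hp (hm.trans (by rw [sup_comm]))⟩

theorem IsJPair.topReducible_value (h : IsJPair ord p q y) : TopReducible ord (value y) :=
  h.topReducibleBy_or.elim (fun h => ⟨q, h.2⟩) fun h => ⟨p, h.2⟩

theorem IsJPair.snd_eq_or (h : IsJPair ord p q y) : y.2 = p ∨ y.2 = q :=
  h.topReducibleBy_or.imp And.left And.left

theorem IsJPair.not_isSyzygy_snd (h : IsJPair ord p q y) : ¬ IsSyzygy ord y.2 :=
  isSyzygy_value_iff.not.1 h.topReducible_value.choose_spec.1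

theorem IsJPair.fst_ne_zero (h : IsJPair ord p q y) (hp : ¬ TopReducible ord p)
    (hq : ¬ TopReducible ord q) : y.1 ≠ 0 := by
  obtain ⟨m, r⟩ := y
  rintro rfl
  have hr : TopReducible ord r := value_zero r ▸ h.topReducible_value
  rcases h.snd_eq_or with rfl | rfl
  · exact hp hr
  · exact hq hr

theorem sig_snd_lt_sig_value (hx : sig ord x.2 ≠ ⊥) (h : x.1 ≠ 0) :
    sig ord x.2 < sig ord (value x) := by
  rw [sig_value]
  exact lt_mulSig h hx

theorem eq_of_sig_value_eq_basis {i : Fin d} (h : sig ord (value x) = (Sig.basis i : Sig ord d)) :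
    x = (0, value x) := by
  have hx : sig ord x.2 ≠ ⊥ := fun hx => by simp [sig_value, hx] at h
  have hdvd := sigDivides_sig_value hx
  rw [h] at hdvd
  have hx0 : x.1 = 0 := by
    by_contra hx0
    exact (sig_snd_lt_sig_value hx hx0).ne (hdvd.eq_basis.trans h.symm)
  have hx_eq : x = (0, x.2) := Prod.ext hx0 rfl
  rw [hx_eq, value_zero]

theorem IsJPair.sig_left_lt (h : IsJPair ord p q y) (hp : ¬ TopReducible ord p)
    (hq : ¬ TopReducible ord q) : sig ord p < sig ord (value y) := by
  rcases h.topReducibleBy_or with ⟨rfl, -⟩ | ⟨-, hred⟩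
  · exact sig_snd_lt_sig_value (sig_ne_bot h.not_isSyzygy_snd) (h.fst_ne_zero hp hq)
  · obtain ⟨m, hm⟩ := topReducibleBy_iff_exists.1 hred
    exact (sig_le_sig_value (m, p)).trans_lt (topReducibleByM_iff.1 hm).2.2

theorem TopReducibleBy.exists_isJPair {m : Fin n →₀ ℕ}
    (h : TopReducibleBy ord (value (m, p)) q) : ∃ m' ≤ m, IsJPair ord p q (m', p) := by
  have hp : ¬ IsSyzygy ord p := isSyzygy_value_iff.not.1 h.1
  have hq : ¬ IsSyzygy ord q := h.2.1
  obtain ⟨k, hk⟩ := topReducibleBy_iff_exists.1 h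
  obtain ⟨-, hlm, hlt⟩ := topReducibleByM_iff.1 hk
  have hpq : PairLT ord p q := (pairLT_iff_sig_value_lt hp hlm).2 hlt
  refine ⟨(ord.degree (Pair.v p) ⊔ ord.degree (Pair.v q)) - ord.degree (Pair.v p), ?_, hp, hq,
    fun hsim => hpq.ne hsim, .inl ⟨hpq, rfl⟩, rfl⟩
  rw [lm_value, lm_value, lm_eq_coe_degree hp, lm_eq_coe_degree hq] at hlm
  have hdeg : m + ord.degree (Pair.v p) = k + ord.degree (Pair.v q) := WithBot.coe_injective hlm
  exact tsub_le_iff_right.2 (sup_le le_add_self (hdeg ▸ le_add_self))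

end Reductions

section Homogeneity

variable {K : Type*} [Field K] {n d : ℕ} {ord : MonomialOrder (Fin n)}
  {f : Fin d → MvPolynomial (Fin n) K} {k : Fin d → ℕ} {D E : ℕ} {p q : Pair f} {x : MPair f}

/-- The pair `p` is homogeneous of degree `D`, where `E_i` is given the degree `k i`. -/
structure IsHomogeneousPair (k : Fin d → ℕ) (D : ℕ) (p : Pair f) : Prop where
  u_degree : ∀ i a, coeff a (Pair.u p i) ≠ 0 → a.degree + k i = D
  v_isHomogeneous : (Pair.v p).IsHomogeneous D

theorem isHomogeneousPair_initialPair (hf : ∀ i, (f i).IsHomogeneous (k i)) (i : Fin d) :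
    IsHomogeneousPair k (k i) (initialPair f i) where
  u_degree j a ha := by
    change coeff a ((Pi.single i 1 : Fin d → MvPolynomial (Fin n) K) j) ≠ 0 at ha
    obtain rfl : j = i := by
      by_contra hj
      simp [hj] at ha
    obtain rfl : a = 0 := by
      by_contra ha'
      simp [coeff_one, Ne.symm ha'] at ha
    simp
  v_isHomogeneous := hf i

theorem IsHomogeneousPair.monomial_smul (h : IsHomogeneousPair k D p) (m : Fin n →₀ ℕ) (c : K) :
    IsHomogeneousPair k (m.degree + D) (monomial m c • p) where
  u_degree i a ha := by
    change coeff a (monomial m c * Pair.u p i) ≠ 0 at ha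
    obtain ⟨b, rfl⟩ : ∃ b, a = m + b := exists_add_of_le <| by
      by_contra hle
      exact ha (by rw [coeff_monomial_mul', if_neg hle])
    rw [coeff_monomial_mul] at ha
    rw [← h.u_degree i b (right_ne_zero_of_mul ha), map_add, add_assoc]
  v_isHomogeneous := (isHomogeneous_monomial c rfl).mul h.v_isHomogeneous

theorem IsHomogeneousPair.value (h : IsHomogeneousPair k D x.2) :
    IsHomogeneousPair k (x.1.degree + D) (value x) :=
  h.monomial_smul x.1 1

theorem IsHomogeneousPair.sub (hp : IsHomogeneousPair k D p) (hq : IsHomogeneousPair k D q) :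
    IsHomogeneousPair k D (p - q) where
  u_degree i a ha := by
    change coeff a (Pair.u p i - Pair.u q i) ≠ 0 at ha
    rw [coeff_sub, sub_ne_zero] at ha
    rcases eq_or_ne (coeff a (Pair.u p i)) 0 with h0 | h0
    · exact hq.u_degree i a (h0 ▸ ha.symm)
    · exact hp.u_degree i a h0
  v_isHomogeneous := hp.v_isHomogeneous.sub hq.v_isHomogeneous

theorem IsHomogeneousPair.deg_lm (hp : IsHomogeneousPair k D p) (h : ¬ IsSyzygy ord p) :
    (ord.degree (Pair.v p)).degree = D := by
  rw [Finsupp.degree_eq_weight_one]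
  exact hp.v_isHomogeneous (ord.leadingCoeff_ne_zero_iff.2 (isSyzygy_iff.not.1 h))

theorem IsHomogeneousPair.deg_eq (hp : IsHomogeneousPair k D p) (h : ¬ IsSyzygy ord p)
    {s : Sig ord d} (hs : sig ord p = s) : deg ord p = (s.mon.degree + k s.index : ℕ) := by
  rw [deg, lm_eq_coe_degree h, WithBot.map_coe, hp.deg_lm h,
    hp.u_degree _ _ (ucoeff_ne_zero_of_sig_eq hs)]
  rfl

theorem IsHomogeneousPair.topReduct (hp : IsHomogeneousPair k D p)
    (hx : IsHomogeneousPair k E x.2) (h : TopReducibleByM ord p x) :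
    IsHomogeneousPair k D (topReduct ord p x) := by
  have hlm := h.2
  rw [lm_value, lm_eq_coe_degree h.1.1, lm_eq_coe_degree h.1.2.1, ← WithBot.coe_add,
    WithBot.coe_inj] at hlm
  have hD : x.1.degree + E = D := by
    rw [← hp.deg_lm h.1.1, ← hx.deg_lm h.1.2.1, hlm, map_add]
  exact hp.sub (hD ▸ hx.monomial_smul _ _)

/-- The properties of the values of the multiplied pairs in `TODO` which make `≺_F5` a comparison of
signatures by index and degree. Initial pairs are the only syzygy pairs that can occur. -/
structure IsCandidate (ord : MonomialOrder (Fin n)) (k : Fin d → ℕ) (p : Pair f) : Prop where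
  homogeneous : ∃ D, IsHomogeneousPair k D p
  initial_or_topReducible : (∃ i, p = initialPair f i) ∨
    (TopReducible ord p ∧ ∀ i, sig ord p ≠ (Sig.basis i : Sig ord d))

theorem isCandidate_initialPair (hf : ∀ i, (f i).IsHomogeneous (k i)) (i : Fin d) :
    IsCandidate ord k (initialPair f i) :=
  ⟨⟨_, isHomogeneousPair_initialPair hf i⟩, .inl ⟨i, rfl⟩⟩

theorem IsJPair.isCandidate_value (h : IsJPair ord p q x) (hp : ¬ TopReducible ord p)
    (hq : ¬ TopReducible ord q) (hx : ∃ D, IsHomogeneousPair k D x.2) :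
    IsCandidate ord k (value x) where
  homogeneous := hx.imp' _ fun _ hD => hD.value
  initial_or_topReducible := by
    have hne := sig_ne_bot h.not_isSyzygy_snd
    refine .inr ⟨h.topReducible_value, fun i hi => ?_⟩
    have hdvd := sigDivides_sig_value hne
    exact (sig_snd_lt_sig_value hne (h.fst_ne_zero hp hq)).ne
      ((hi ▸ hdvd).eq_basis.trans hi.symm)

namespace IsCandidate

theorem exists_eq_initialPair (h : IsCandidate ord k p) (hp : ¬ TopReducible ord p) :
    ∃ i, p = initialPair f i :=
  h.initial_or_topReducible.resolve_right fun hred => hp hred.1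

theorem exists_eq_initialPair_of_isSyzygy (h : IsCandidate ord k p) (hp : IsSyzygy ord p) :
    ∃ i, p = initialPair f i :=
  h.exists_eq_initialPair fun ⟨_, hq⟩ => hq.1 hp

protected theorem sig_ne_bot (h : IsCandidate ord k p) : sig ord p ≠ ⊥ := by
  by_cases hp : IsSyzygy ord p
  · obtain ⟨i, rfl⟩ := h.exists_eq_initialPair_of_isSyzygy hp
    simp [sig_initialPair]
  · exact sig_ne_bot hp

theorem eq_initialPair (h : IsCandidate ord k p) {i : Fin d}
    (hi : sig ord p = (Sig.basis i : Sig ord d)) : p = initialPair f i := by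
  obtain ⟨j, rfl⟩ := h.initial_or_topReducible.resolve_right fun hred => hred.2 i hi
  rw [sig_initialPair] at hi
  rw [show j = i from congrArg Sig.index (WithBot.coe_injective hi)]

theorem degree_mon_eq_zero_of_isSyzygy (h : IsCandidate ord k p) (hp : IsSyzygy ord p)
    {s : Sig ord d} (hs : sig ord p = s) : s.mon.degree = 0 := by
  obtain ⟨i, rfl⟩ := h.exists_eq_initialPair_of_isSyzygy hp
  rw [sig_initialPair] at hs
  rw [← WithBot.coe_injective hs, Sig.basis, map_zero]

theorem deg_lt_deg_iff (hp : IsCandidate ord k p) (hq : IsCandidate ord k q) {s t : Sig ord d}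
    (hs : sig ord p = s) (ht : sig ord q = t) (hst : s.index = t.index) :
    deg ord p < deg ord q ↔ s.mon.degree < t.mon.degree := by
  obtain ⟨D, hpD⟩ := hp.homogeneous
  obtain ⟨E, hqE⟩ := hq.homogeneous
  by_cases hq_syz : IsSyzygy ord q
  · have hq_deg : deg ord q = ⊥ := by rw [deg, hq_syz, WithBot.map_bot]
    simp [hq_deg, hq.degree_mon_eq_zero_of_isSyzygy hq_syz ht]
  by_cases hp_syz : IsSyzygy ord p
  · have hp_deg : deg ord p = ⊥ := by rw [deg, hp_syz, WithBot.map_bot]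
    rw [hp_deg, hqE.deg_eq hq_syz ht, hp.degree_mon_eq_zero_of_isSyzygy hp_syz hs]
    refine iff_of_true (WithBot.bot_lt_coe _) (Nat.pos_of_ne_zero fun h0 => hq_syz ?_)
    have hs_basis : s = Sig.basis t.index := Sig.ext hst
      ((Finsupp.degree_eq_zero_iff _).1 (hp.degree_mon_eq_zero_of_isSyzygy hp_syz hs))
    have ht_basis : t = Sig.basis t.index := Sig.ext rfl ((Finsupp.degree_eq_zero_iff _).1 h0)
    rwa [hq.eq_initialPair (ht.trans (congrArg _ ht_basis)),
      ← hp.eq_initialPair (hs.trans (congrArg _ hs_basis))]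
  · rw [hpD.deg_eq hp_syz hs, hqE.deg_eq hq_syz ht, Nat.cast_lt, hst,
      Nat.add_lt_add_iff_right]

theorem f5LT_iff (hp : IsCandidate ord k p) (hq : IsCandidate ord k q) :
    F5LT ord p q ↔ sigGrade (sig ord p) < sigGrade (sig ord q) := by
  obtain ⟨s, hs⟩ := WithBot.ne_bot_iff_exists.1 hp.sig_ne_bot
  obtain ⟨t, ht⟩ := WithBot.ne_bot_iff_exists.1 hq.sig_ne_bot
  have hgrade : sigGrade (sig ord p) < sigGrade (sig ord q) ↔
      t.index < s.index ∨ s.index = t.index ∧ s.mon.degree < t.mon.degree := by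
    simp [← hs, ← ht, sigGrade, Sig.grade, Prod.Lex.toLex_lt_toLex]
  rw [hgrade]
  constructor
  · rintro ⟨s', t', hs', ht', h⟩
    obtain rfl := WithBot.coe_injective (hs.trans hs')
    obtain rfl := WithBot.coe_injective (ht.trans ht')
    exact h.imp_right fun ⟨hi, h⟩ => ⟨hi, (hp.deg_lt_deg_iff hq hs' ht' hi).1 h⟩
  · exact fun h => ⟨s, t, hs.symm, ht.symm,
      h.imp_right fun ⟨hi, h⟩ => ⟨hi, (hp.deg_lt_deg_iff hq hs.symm ht.symm hi).2 h⟩⟩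

end IsCandidate

end Homogeneity

section Criteria

variable {K : Type*} [Field K] {n d : ℕ} {ord : MonomialOrder (Fin n)}
  {f : Fin d → MvPolynomial (Fin n) K} {D : Set (Pair f)} {R : List (Pair f)} {p q r : Pair f}
  {x y : MPair f} {s t : WithBot (Sig ord d)}

theorem MeetsSyzygy.congr (h : MeetsSyzygy ord D x) (hxy : sig ord (value x) = sig ord (value y)) :
    MeetsSyzygy ord D y := by
  obtain ⟨p, hp, s, s₁, a, hx, hs₁, ha, hlt, hdvd⟩ := h
  rw [hxy] at hdvd
  rw [sig_value, hx, mulSig_coe_coe] at hxy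
  obtain ⟨t, ht⟩ : ∃ t : Sig ord d, sig ord y.2 = t :=
    (WithBot.ne_bot_iff_exists.1 fun hy => by simp [sig_value, hy] at hxy).imp fun _ => Eq.symm
  have hst : s.index = t.index := by
    rw [sig_value, ht, mulSig_coe_coe] at hxy
    have hmul : Sig.mul x.1 s = Sig.mul y.1 t := WithBot.coe_injective hxy
    simpa using congrArg Sig.index hmul
  exact ⟨p, hp, t, s₁, a, ht, hs₁, ha, hst ▸ hlt, hst ▸ hdvd⟩

theorem meetsSyzygy_insert :
    MeetsSyzygy ord (insert q D) x ↔ MeetsSyzygy ord {q} x ∨ MeetsSyzygy ord D x := by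
  simp only [MeetsSyzygy, Set.exists_mem_insert, Set.mem_singleton_iff, exists_eq_left]

theorem MeetsSyzygy.sigGrade_lt (h : MeetsSyzygy ord {q} x) :
    sigGrade (sig ord q) < sigGrade (sig ord (value x)) := by
  obtain ⟨_, rfl, s, s₁, a, hs, hs₁, -, hlt, -⟩ := h
  rw [sig_value, hs, hs₁, mulSig_coe_coe]
  exact WithBot.coe_lt_coe.2 (Prod.Lex.toLex_lt_toLex.2 (.inl hlt))

open Classical in
/-- The entry of the rewrite rule list `R` that decides the Rewritten Criterion for multiplied pairs
of signature `s`: the first one whose signature divides `s`. -/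
noncomputable def rewriter (R : List (Pair f)) (s : WithBot (Sig ord d)) : Option (Pair f) :=
  R.find? fun r => decide (SigDivides ord (sig ord r) s)

theorem meetsRewritten_iff :
    MeetsRewritten ord R x ↔ ∃ r, rewriter R (sig ord (value x)) = some r ∧ x.2 ≠ r := Iff.rfl

theorem rewriter_eq_some_iff :
    rewriter R s = some r ↔ SigDivides ord (sig ord r) s ∧
      ∃ R₁ R₂, R = R₁ ++ r :: R₂ ∧ ∀ a ∈ R₁, ¬ SigDivides ord (sig ord a) s := by
  simp only [rewriter, List.find?_eq_some_iff_append, decide_eq_true_eq, decide_eq_false_iff_not,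
    Bool.not_eq_true']

theorem exists_rewriter (hr : r ∈ R) (h : SigDivides ord (sig ord r) s) :
    ∃ q, rewriter R s = some q :=
  Option.isSome_iff_exists.1 (List.find?_isSome.2 ⟨r, hr, by simpa using h⟩)

theorem mem_of_rewriter_eq_some (h : rewriter R s = some r) : r ∈ R :=
  List.mem_of_find?_eq_some h

theorem sigDivides_of_rewriter_eq_some (h : rewriter R s = some r) :
    SigDivides ord (sig ord r) s :=
  (rewriter_eq_some_iff.1 h).1

theorem rewriter_eq_some_of_sigDivides (h : rewriter R t = some r)
    (hr : SigDivides ord (sig ord r) s) (hst : SigDivides ord s t) : rewriter R s = some r := by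
  obtain ⟨-, R₁, R₂, hR, hR₁⟩ := rewriter_eq_some_iff.1 h
  exact rewriter_eq_some_iff.2 ⟨hr, R₁, R₂, hR, fun a ha hdvd => hR₁ a ha (hdvd.trans hst)⟩

theorem MeetsRewritten.cons (h : MeetsRewritten ord R x) (hp : x.2 ≠ p) :
    MeetsRewritten ord (p :: R) x := by
  obtain ⟨r, hr, hne⟩ := meetsRewritten_iff.1 h
  rw [rewriter] at hr
  by_cases hdvd : SigDivides ord (sig ord p) (sig ord (value x))
  · exact ⟨p, by simp [hdvd], hp⟩
  · exact ⟨r, by simpa [hdvd] using hr, hne⟩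

theorem map_sig_replaceRule (h : sig ord q = sig ord p) :
    (replaceRule R p q).map (sig ord) = R.map (sig ord) := by
  rw [replaceRule, List.map_map]
  refine List.map_congr_left fun r _ => ?_
  by_cases hr : r = p <;> simp [hr, h]

theorem mem_replaceRule (h : r ∈ replaceRule R p q) : r = q ∨ r ∈ R ∧ r ≠ p := by
  obtain ⟨a, ha, rfl⟩ := List.mem_map.1 h
  by_cases hap : a = p <;> simp [hap, ha]

theorem mem_replaceRule_of_ne (hr : r ∈ R) (h : r ≠ p) : r ∈ replaceRule R p q :=
  List.mem_map.2 ⟨r, hr, if_neg h⟩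

theorem mem_replaceRule_self (hp : p ∈ R) : q ∈ replaceRule R p q :=
  List.mem_map.2 ⟨p, hp, if_pos rfl⟩

theorem MeetsRewritten.replaceRule (h : MeetsRewritten ord R x) (hpq : sig ord q = sig ord p)
    (hq : x.2 ≠ q) : MeetsRewritten ord (replaceRule R p q) x := by
  classical
  obtain ⟨r, hr, hne⟩ := meetsRewritten_iff.1 h
  refine ⟨if r = p then q else r, ?_, by split_ifs <;> assumption⟩
  rw [rewriter] at hr
  rw [TRBF5.replaceRule, List.find?_map]
  have hcomp : ((fun r => decide (SigDivides ord (sig ord r) (sig ord (value x)))) ∘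
      fun r => if r = p then q else r) =
      fun r => decide (SigDivides ord (sig ord r) (sig ord (value x))) := by
    funext r
    by_cases hrp : r = p <;> simp [hrp, hpq]
  rw [hcomp, hr, Option.map_some]

/-- The entries of `R` have nonzero signatures, none of which is divisible by the signature of an
earlier entry. -/
structure IsReducedRules (ord : MonomialOrder (Fin n)) (R : List (Pair f)) : Prop where
  sig_ne_bot : ∀ r ∈ R, sig ord r ≠ ⊥
  pairwise : (R.map (sig ord)).Pairwise fun s t => ¬ SigDivides ord s t

namespace IsReducedRules

theorem nil : IsReducedRules ord ([] : List (Pair f)) :=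
  ⟨by simp, List.Pairwise.nil⟩

theorem cons (h : IsReducedRules ord R) (hp : sig ord p ≠ ⊥)
    (hR : ∀ r ∈ R, ¬ SigDivides ord (sig ord p) (sig ord r)) : IsReducedRules ord (p :: R) where
  sig_ne_bot := List.forall_mem_cons.2 ⟨hp, h.sig_ne_bot⟩
  pairwise := List.pairwise_cons.2 ⟨List.forall_mem_map.2 hR, h.pairwise⟩

theorem replaceRule (h : IsReducedRules ord R) (hpq : sig ord q = sig ord p) :
    IsReducedRules ord (replaceRule R p q) where
  sig_ne_bot := by
    have hne : ∀ s ∈ R.map (sig ord), s ≠ ⊥ := List.forall_mem_map.2 h.sig_ne_bot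
    rw [← map_sig_replaceRule hpq] at hne
    exact fun r hr => hne _ (List.mem_map_of_mem hr)
  pairwise := by
    rw [map_sig_replaceRule hpq]
    exact h.pairwise

theorem rewriter_sig (h : IsReducedRules ord R) (hr : r ∈ R) : rewriter R (sig ord r) = some r := by
  obtain ⟨R₁, R₂, rfl⟩ := List.append_of_mem hr
  refine rewriter_eq_some_iff.2 ⟨sigDivides_refl (h.sig_ne_bot r hr), R₁, R₂, rfl, fun a ha => ?_⟩
  have hpair := h.pairwise
  rw [List.map_append, List.pairwise_append] at hpair
  exact hpair.2.2 _ (List.mem_map_of_mem ha) _ (List.mem_map_of_mem (List.mem_cons_self ..))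

theorem eq_of_sig_eq (h : IsReducedRules ord R) (hp : p ∈ R) (hq : q ∈ R)
    (hpq : sig ord p = sig ord q) : p = q :=
  Option.some_injective _ ((h.rewriter_sig hp).symm.trans (hpq ▸ h.rewriter_sig hq))

theorem not_meetsRewritten (h : IsReducedRules ord R) (hr : r ∈ R) :
    ¬ MeetsRewritten ord R (0, r) := by
  rintro ⟨q, hq, hne⟩
  rw [value_zero] at hq
  exact hne (Option.some_injective _ ((h.rewriter_sig hr).symm.trans hq))

end IsReducedRules

end Criteria

section Completeness

variable {K : Type*} [Field K] {n d : ℕ} {ord : MonomialOrder (Fin n)}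
  {f : Fin d → MvPolynomial (Fin n) K} {D : Set (Pair f)} {R : List (Pair f)} {p : Pair f}
  {s t : WithBot (Sig ord d)}

/-- The set `D` and the rewrite rules `R` contain everything the algorithm has to compute in the
signatures up to `s`: the rules of these signatures belong to `D`, and the initial pairs and J-pairs
of these signatures are superfluous because of a syzygy pair or a rule. -/
structure CompleteUpTo (D : Set (Pair f)) (R : List (Pair f)) (s : WithBot (Sig ord d)) : Prop where
  rules_subset : ∀ r ∈ R, sig ord r ≤ s → r ∈ D
  basis : ∀ i, ((Sig.basis i : Sig ord d) : WithBot (Sig ord d)) ≤ s →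
    IsSyzygySig f ((Sig.basis i : Sig ord d) : WithBot (Sig ord d)) ∨
      ∃ r ∈ R, sig ord r = (Sig.basis i : Sig ord d)
  jpair : ∀ p ∈ D, ∀ q ∈ D, ∀ y, IsJPair ord p q y → sig ord (value y) ≤ s →
    IsSyzygySig f (sig ord (value y)) ∨ MeetsRewritten ord R y

namespace CompleteUpTo

theorem mono (h : CompleteUpTo D R t) (hst : s ≤ t) : CompleteUpTo D R s where
  rules_subset r hr hle := h.rules_subset r hr (hle.trans hst)
  basis i hle := h.basis i (hle.trans hst)
  jpair p hp q hq y hy hle := h.jpair p hp q hq y hy (hle.trans hst)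

theorem exists_rewriter (h : CompleteUpTo D R s) (hs : ¬ IsSyzygySig f s) (hs_ne : s ≠ ⊥) :
    ∃ r ∈ D, rewriter R s = some r := by
  obtain ⟨i, hi⟩ := exists_basis_sigDivides hs_ne
  obtain ⟨r, hr, hri⟩ := (h.basis i hi.le).resolve_left fun hsyz => hs (hsyz.of_sigDivides hi)
  obtain ⟨q, hq⟩ := TRBF5.exists_rewriter hr (hri ▸ hi)
  exact ⟨q, h.rules_subset q (mem_of_rewriter_eq_some hq) (sigDivides_of_rewriter_eq_some hq).le,
    hq⟩

/-- The J-pair of `r` and a reducer of `m r` has a signature dividing that of `m r`, so `r` is its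
rewriter, too. -/
theorem not_topReducibleBy_value (h : CompleteUpTo D R s) (hs : ¬ IsSyzygySig f s) {r q : Pair f}
    (hr : r ∈ D) (hr_rewriter : rewriter R s = some r) {m : Fin n →₀ ℕ}
    (hm : sig ord (value (m, r)) = s) (hq : q ∈ D) : ¬ TopReducibleBy ord (value (m, r)) q := by
  intro hred
  obtain ⟨m', hle, hJ⟩ := hred.exists_isJPair
  obtain ⟨a, rfl⟩ := exists_add_of_le hle
  have hr_ne : sig ord r ≠ ⊥ := sig_ne_bot hJ.1
  have hdvd_left : SigDivides ord (sig ord r) (sig ord (value (m', r))) :=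
    sigDivides_sig_value (x := (m', r)) hr_ne
  have hdvd : SigDivides ord (sig ord (value (m', r))) s := by
    rw [← hm, sig_value (m' + a, r), add_comm, WithBot.coe_add, ← mulSig_mulSig,
      ← sig_value (m', r)]
    exact sigDivides_mulSig a hdvd_left.ne_bot_right
  rcases h.jpair r hr q hq _ hJ hdvd.le with hsyz | ⟨r', hr', hne⟩
  · exact hs (hsyz.of_sigDivides hdvd)
  · exact hne (Option.some_injective _
      ((rewriter_eq_some_of_sigDivides hr_rewriter hdvd_left hdvd).symm.trans hr'))

theorem exists_passesF5_of_isTRP (hp : IsTRP ord p) (h : CompleteUpTo D R (sig ord p)) :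
    ∃ x : MPair f, x.2 ∈ D ∧ PassesF5 ord D R x ∧ Equivalent ord p (value x) := by
  induction hs : sig ord p using WellFoundedLT.induction generalizing p with
  | ind s ih =>
    subst hs
    have hsyz := hp.not_isSyzygySig
    obtain ⟨r, hr, hr_rewriter⟩ := h.exists_rewriter hsyz (sig_ne_bot hp.1)
    obtain ⟨m, hm⟩ := (sigDivides_of_rewriter_eq_some hr_rewriter).exists_mulSig
    rw [← sig_value (m, r)] at hm
    have hirred : ¬ TopReducible ord (value (m, r)) := fun hred => by
      obtain ⟨p', hp', hp'_lm, hp'_sig⟩ := hred.exists_isTRP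
      rw [hm] at hp'_sig
      obtain ⟨y, hy, -, hp'y⟩ := ih _ hp'_sig hp' (h.mono hp'_sig.le) rfl
      refine h.not_topReducibleBy_value hsyz hr hr_rewriter hm hy
        (topReducibleByM_iff.2 ⟨hred.choose_spec.1, ?_, ?_⟩ : TopReducibleByM ord _ y).1
      · rw [← hp'y.2, hp'_lm]
      · rwa [← hp'y.1, hm]
    have hTRP : IsTRP ord (value (m, r)) := ⟨fun h0 => hsyz ⟨_, hm, h0⟩, hirred⟩
    refine ⟨(m, r), hr, ⟨fun hx => hsyz (hm ▸ hx.isSyzygySig), ?_⟩, hm.symm, hp.lm_eq hTRP hm.symm⟩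
    rintro ⟨r', hr', hne⟩
    rw [hm] at hr'
    exact hne (Option.some_injective _ (hr_rewriter.symm.trans hr'))

theorem f5Reducible (hp : TopReducible ord p) (h : ∀ s < sig ord p, CompleteUpTo D R s) :
    F5Reducible ord D R p := by
  obtain ⟨r, hr, hr_lm, hr_sig⟩ := hp.exists_isTRP
  obtain ⟨x, hx, hx_passes, hrx⟩ := exists_passesF5_of_isTRP hr (h _ hr_sig)
  exact ⟨x, hx, topReducibleByM_iff.2
    ⟨hp.choose_spec.1, hr_lm.symm.trans hrx.2, hrx.1.symm.trans_lt hr_sig⟩, hx_passes⟩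

theorem exists_equivalent_of_isTRB (h : CompleteUpTo D R (sig ord p))
    (hD : ∀ q ∈ D, ¬ TopReducible ord q) (hp : IsTRB ord p) : ∃ q ∈ D, Equivalent ord p q := by
  obtain ⟨x, hx, -, hsig, hlm⟩ := exists_passesF5_of_isTRP hp.1 h
  have hTRP : IsTRP ord x.2 := by
    refine ⟨fun hsyz => hp.1.1 ?_, hD _ hx⟩
    rw [IsSyzygy, hlm]
    exact isSyzygy_value_iff.2 hsyz
  have hdvd : SigDivides ord (sig ord x.2) (sig ord p) :=
    hsig ▸ sigDivides_sig_value (sig_ne_bot hTRP.1)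
  have hsim : Similar ord x.2 p := by
    rw [Similar, hsig, hlm, sig_value, lm_value, mulSig_mulSig, add_comm]
  have heq := (hp.2 _ hTRP hsim hdvd).symm
  exact ⟨x.2, hx, heq, hp.1.lm_eq hTRP heq⟩

end CompleteUpTo

end Completeness

section Invariant

variable {K : Type*} [Field K] {n d : ℕ} {ord : MonomialOrder (Fin n)}
  {f : Fin d → MvPolynomial (Fin n) K} {k : Fin d → ℕ} {D : Set (Pair f)} {T : Set (MPair f)}
  {R : List (Pair f)} {p q r : Pair f} {x y : MPair f} {s : WithBot (Sig ord d)}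

/-- What is known of the value `p` of a multiplied pair waiting to be processed, where `D` is `DONE`
and `R` is the rewrite rule list: the algorithm proceeds by increasing signatures, and the rules are
added in the order of increasing grade. -/
structure IsPending (ord : MonomialOrder (Fin n)) (k : Fin d → ℕ) (D : Set (Pair f))
    (R : List (Pair f)) (p : Pair f) : Prop extends IsCandidate ord k p where
  notMem_done : p ∉ D
  sig_done_le : ∀ q ∈ D, sig ord q ≤ sig ord p
  sigGrade_rules_le : ∀ r ∈ R, sigGrade (sig ord r) ≤ sigGrade (sig ord p)

/-- The invariant of the algorithm, in terms of `DONE`, the set `T` of the multiplied pairs waiting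
to be processed, and the rewrite rule list `R`. -/
structure Consistent (ord : MonomialOrder (Fin n)) (k : Fin d → ℕ) (D : Set (Pair f))
    (T : Set (MPair f)) (R : List (Pair f)) : Prop where
  isPending : ∀ x ∈ T, IsPending ord k D R (value x)
  isReducedRules : IsReducedRules ord R
  not_meetsSyzygy : ∀ r ∈ R, ¬ MeetsSyzygy ord D (0, r)
  rule_processed : ∀ r ∈ R, r ∈ D ∨ (0, r) ∈ T
  done_subset : ∀ p ∈ D, p ∈ R
  done_homogeneous : ∀ p ∈ D, ∃ E, IsHomogeneousPair k E p
  done_irreducible : ∀ p ∈ D, ¬ TopReducible ord p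
  initial_processed : ∀ i, (0, initialPair f i) ∈ T ∨
    IsSyzygySig f ((Sig.basis i : Sig ord d) : WithBot (Sig ord d)) ∨
      ∃ r ∈ R, sig ord r = (Sig.basis i : Sig ord d)
  jpair_processed : ∀ p ∈ D, ∀ q ∈ D, ∀ y, IsJPair ord p q y →
    y ∈ T ∨ IsSyzygySig f (sig ord (value y)) ∨ MeetsRewritten ord R y

namespace Consistent

theorem initial (hf : ∀ i, (f i).IsHomogeneous (k i)) :
    Consistent ord k ∅ (Set.range fun i => (0, initialPair f i)) [] where
  isPending := by
    rintro _ ⟨i, rfl⟩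
    rw [value_zero]
    exact ⟨isCandidate_initialPair hf i, Set.notMem_empty _, by simp, by simp⟩
  isReducedRules := .nil
  not_meetsSyzygy := by simp
  rule_processed := by simp
  done_subset := by simp
  done_homogeneous := by simp
  done_irreducible := by simp
  initial_processed i := .inl ⟨i, rfl⟩
  jpair_processed := by simp

theorem passesF5 (h : Consistent ord k D T R) (hr : r ∈ R) : PassesF5 ord D R (0, r) :=
  ⟨h.not_meetsSyzygy r hr, h.isReducedRules.not_meetsRewritten hr⟩

theorem completeUpTo (h : Consistent ord k D T R) (hs : ∀ y ∈ T, s < sig ord (value y)) :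
    CompleteUpTo D R s where
  rules_subset r hr hle := (h.rule_processed r hr).resolve_right fun hT =>
    hle.not_gt (by simpa using hs _ hT)
  basis i hle := (h.initial_processed i).resolve_left fun hT =>
    hle.not_gt (by simpa [sig_initialPair] using hs _ hT)
  jpair p hp q hq y hy hle := (h.jpair_processed p hp q hq y hy).resolve_left fun hT =>
    hle.not_gt (hs y hT)

theorem not_sigDivides (h : Consistent ord k D T R) (hx : x ∈ T)
    (hrew : ¬ MeetsRewritten ord R x) (hxR : ¬ (x.1 = 0 ∧ x.2 ∈ R)) (hr : r ∈ R) :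
    ¬ SigDivides ord (sig ord (value x)) (sig ord r) := by
  intro hdvd
  have hsig := hdvd.eq_of_sigGrade_le ((h.isPending x hx).sigGrade_rules_le r hr)
  obtain rfl : x.2 = r := by
    by_contra hne
    exact hrew ⟨r, hsig ▸ h.isReducedRules.rewriter_sig hr, hne⟩
  refine hxR ⟨by_contra fun hx0 => ?_, hr⟩
  exact (sig_snd_lt_sig_value (h.isReducedRules.sig_ne_bot _ hr) hx0).ne' hsig

theorem prepend (h : Consistent ord k D T R) (hx : x ∈ T)
    (hmin : ∀ y ∈ T, sigGrade (sig ord (value x)) ≤ sigGrade (sig ord (value y)))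
    (hpass : PassesF5 ord D R x) (hxR : ¬ (x.1 = 0 ∧ x.2 ∈ R)) :
    Consistent ord k D (insert (0, value x) (T \ {x})) (value x :: R) where
  isPending := by
    have of_mem : ∀ y ∈ T, IsPending ord k D (value x :: R) (value y) := fun y hy =>
      { h.isPending y hy with
        sigGrade_rules_le :=
          List.forall_mem_cons.2 ⟨hmin y hy, (h.isPending y hy).sigGrade_rules_le⟩ }
    rintro y (rfl | hy)
    · rw [value_zero]
      exact of_mem x hx
    · exact of_mem y hy.1
  isReducedRules := h.isReducedRules.cons (h.isPending x hx).sig_ne_bot fun r hr =>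
    h.not_sigDivides hx hpass.2 hxR hr
  not_meetsSyzygy := List.forall_mem_cons.2
    ⟨fun hsyz => hpass.1 (hsyz.congr (by rw [value_zero])), h.not_meetsSyzygy⟩
  rule_processed := by
    refine List.forall_mem_cons.2 ⟨.inr (.inl rfl), fun r hr => ?_⟩
    refine (h.rule_processed r hr).imp_right fun hT => .inr ⟨hT, ?_⟩
    rintro rfl
    exact hxR ⟨rfl, hr⟩
  done_subset p hp := List.mem_cons_of_mem _ (h.done_subset p hp)
  done_homogeneous := h.done_homogeneous
  done_irreducible := h.done_irreducible
  initial_processed i := by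
    rcases h.initial_processed i with hT | hsyz | ⟨r, hr, hri⟩
    · by_cases hx : (0, initialPair f i) = x
      · refine .inr (.inr ⟨value x, List.mem_cons_self .., ?_⟩)
        rw [← hx, value_zero, sig_initialPair]
      · exact .inl (.inr ⟨hT, hx⟩)
    · exact .inr (.inl hsyz)
    · exact .inr (.inr ⟨r, List.mem_cons_of_mem _ hr, hri⟩)
  jpair_processed p hp q hq y hy := by
    have hne : y.2 ≠ value x := fun heq => (h.isPending x hx).notMem_done
      (heq ▸ hy.snd_eq_or.elim (fun h => h ▸ hp) fun h => h ▸ hq)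
    rcases h.jpair_processed p hp q hq y hy with hT | hsyz | hrew
    · by_cases hyx : y = x
      · refine .inr (.inr ⟨value x, ?_, hne⟩)
        subst hyx
        exact rewriter_eq_some_iff.2
          ⟨sigDivides_refl (h.isPending y hx).sig_ne_bot, [], R, rfl, by simp⟩
      · exact .inl (.inr ⟨hT, hyx⟩)
    · exact .inr (.inl hsyz)
    · exact .inr (.inr (hrew.cons hne))

theorem erase (h : Consistent ord k D T R) (hx : ¬ PassesF5 ord D R x) :
    Consistent ord k D (T \ {x}) R where
  isPending y hy := h.isPending y hy.1
  isReducedRules := h.isReducedRules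
  not_meetsSyzygy := h.not_meetsSyzygy
  rule_processed r hr := (h.rule_processed r hr).imp_right fun hT => ⟨hT, by
    rintro rfl
    exact hx (h.passesF5 hr)⟩
  done_subset := h.done_subset
  done_homogeneous := h.done_homogeneous
  done_irreducible := h.done_irreducible
  initial_processed i := by
    by_cases hxi : (0, initialPair f i) = x
    · subst hxi
      have hsig : sig ord (value (0, initialPair f i)) = (Sig.basis i : Sig ord d) := by
        rw [value_zero, sig_initialPair]
      rcases not_and_or.1 hx with hx | hx
      · exact .inr (.inl (hsig ▸ (not_not.1 hx).isSyzygySig))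
      · obtain ⟨r, hr, -⟩ := not_not.1 hx
        refine .inr (.inr ⟨r, mem_of_rewriter_eq_some hr, ?_⟩)
        exact (hsig ▸ sigDivides_of_rewriter_eq_some hr).eq_basis
    · exact (h.initial_processed i).imp_left fun hT => ⟨hT, hxi⟩
  jpair_processed p hp q hq y hy := by
    by_cases hyx : y = x
    · subst hyx
      exact .inr ((not_and_or.1 hx).imp (fun h => (not_not.1 h).isSyzygySig) not_not.1)
    · exact (h.jpair_processed p hp q hq y hy).imp_left fun hT => ⟨hT, hyx⟩

theorem notMem_done_of_sig_eq (h : Consistent ord k D T R) (hpT : (0, p) ∈ T) (hpR : p ∈ R)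
    (hqp : sig ord q = sig ord p) : q ∉ D := fun hq =>
  (h.isPending _ hpT).notMem_done <| by
    rwa [value_zero, h.isReducedRules.eq_of_sig_eq hpR (h.done_subset q hq) hqp.symm]

theorem isPending_store_of_mem (h : Consistent ord k D T R) (hpT : (0, p) ∈ T) (hpR : p ∈ R)
    (hmin : ∀ y ∈ T, sig ord p ≤ sig ord (value y)) (hqp : sig ord q = sig ord p)
    (hq : ¬ TopReducible ord q) (hy : y ∈ T) (hyp : y ≠ (0, p)) :
    IsPending ord k (insert q D) (replaceRule R p q) (value y) where
  toIsCandidate := (h.isPending y hy).toIsCandidate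
  notMem_done := by
    rintro (rfl | hyD)
    · obtain ⟨i, hi⟩ := (h.isPending y hy).exists_eq_initialPair hq
      have hy_sig : sig ord (value y) = (Sig.basis i : Sig ord d) := hi ▸ sig_initialPair i
      have hp : IsCandidate ord k p := by
        simpa using (h.isPending _ hpT).toIsCandidate
      refine hyp ((eq_of_sig_value_eq_basis hy_sig).trans ?_)
      rw [hi, hp.eq_initialPair (hqp.symm.trans hy_sig)]
    · exact (h.isPending y hy).notMem_done hyD
  sig_done_le := Set.forall_mem_insert.2
    ⟨hqp.trans_le (hmin y hy), (h.isPending y hy).sig_done_le⟩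
  sigGrade_rules_le r hr := by
    rcases mem_replaceRule hr with rfl | ⟨hr, -⟩
    · exact hqp ▸ (h.isPending y hy).sigGrade_rules_le p hpR
    · exact (h.isPending y hy).sigGrade_rules_le r hr

theorem isPending_store_of_isJPair (hord : IsHomogeneousOrder ord) (h : Consistent ord k D T R)
    (hpT : (0, p) ∈ T) (hqp : sig ord q = sig ord p) (hq_hom : ∃ E, IsHomogeneousPair k E q)
    (hq : ¬ TopReducible ord q) (hr : r ∈ D) (hy : IsJPair ord q r y) :
    IsPending ord k (insert q D) (replaceRule R p q) (value y) := by
  have hp : IsPending ord k D R p := by simpa using h.isPending _ hpT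
  have hr_irred := h.done_irreducible r hr
  have hlt : sig ord q < sig ord (value y) := hy.sig_left_lt hq hr_irred
  have hle : ∀ a ∈ insert q D, sig ord a ≤ sig ord q :=
    Set.forall_mem_insert.2 ⟨le_rfl, fun a ha => hqp ▸ hp.sig_done_le a ha⟩
  refine ⟨hy.isCandidate_value hq hr_irred ?_, fun hyD => hlt.not_ge (hle _ hyD),
    fun a ha => (hle a ha).trans hlt.le, fun a ha => ?_⟩
  · rcases hy.snd_eq_or with h_eq | h_eq
    · exact h_eq ▸ hq_hom
    · exact h_eq ▸ h.done_homogeneous r hr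
  · refine le_trans ?_ (sigGrade_monotone hord hlt.le)
    rcases mem_replaceRule ha with rfl | ⟨ha, -⟩
    · exact le_rfl
    · exact hqp ▸ hp.sigGrade_rules_le a ha

theorem not_meetsSyzygy_store (h : Consistent ord k D T R) (hpT : (0, p) ∈ T) (hpR : p ∈ R)
    (hqp : sig ord q = sig ord p) (hr : r ∈ replaceRule R p q) :
    ¬ MeetsSyzygy ord (insert q D) (0, r) := by
  obtain ⟨a, ha, har⟩ : ∃ a ∈ R, sig ord a = sig ord r := by
    rcases mem_replaceRule hr with rfl | ⟨hr, -⟩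
    exacts [⟨p, hpR, hqp.symm⟩, ⟨r, hr, rfl⟩]
  rw [meetsSyzygy_insert]
  rintro (hsyz | hsyz)
  · have hlt := hsyz.sigGrade_lt
    rw [value_zero, hqp, ← har] at hlt
    have hp : IsPending ord k D R p := by simpa using h.isPending _ hpT
    exact hlt.not_ge (hp.sigGrade_rules_le a ha)
  · exact h.not_meetsSyzygy a ha (hsyz.congr (by rw [value_zero, value_zero, har]))

theorem jpair_processed_store (h : Consistent ord k D T R) (hpT : (0, p) ∈ T) (hpR : p ∈ R)
    (hqp : sig ord q = sig ord p) {a b : Pair f} (ha : a ∈ insert q D) (hb : b ∈ insert q D)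
    (hy : IsJPair ord a b y) :
    y ∈ T \ {(0, p)} ∪ {y | ∃ r ∈ D, IsJPair ord q r y} ∨
      IsSyzygySig f (sig ord (value y)) ∨ MeetsRewritten ord (replaceRule R p q) y := by
  rcases ha with rfl | ha <;> rcases hb with rfl | hb
  · exact absurd rfl hy.2.2.1
  · exact .inl (.inr ⟨b, hb, hy⟩)
  · exact .inl (.inr ⟨a, ha, hy.symm⟩)
  · rcases h.jpair_processed a ha b hb y hy with hT | hsyz | hrew
    · refine .inl (.inl ⟨hT, ?_⟩)
      rintro rfl
      exact hy.fst_ne_zero (h.done_irreducible a ha) (h.done_irreducible b hb) rfl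
    · exact .inr (.inl hsyz)
    · have hyD : y.2 ∈ D := hy.snd_eq_or.elim (fun h => h ▸ ha) fun h => h ▸ hb
      refine .inr (.inr (hrew.replaceRule hqp ?_))
      rintro rfl
      exact h.notMem_done_of_sig_eq hpT hpR hqp hyD

theorem store (hord : IsHomogeneousOrder ord) (h : Consistent ord k D T R) (hpT : (0, p) ∈ T)
    (hpR : p ∈ R) (hmin : ∀ y ∈ T, sig ord p ≤ sig ord (value y)) (hqp : sig ord q = sig ord p)
    (hq_hom : ∃ E, IsHomogeneousPair k E q) (hq : ¬ TopReducible ord q) :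
    Consistent ord k (insert q D) (T \ {(0, p)} ∪ {y | ∃ r ∈ D, IsJPair ord q r y})
      (replaceRule R p q) where
  isPending := by
    rintro y (⟨hy, hyp⟩ | ⟨r, hr, hy⟩)
    · exact h.isPending_store_of_mem hpT hpR hmin hqp hq hy hyp
    · exact h.isPending_store_of_isJPair hord hpT hqp hq_hom hq hr hy
  isReducedRules := h.isReducedRules.replaceRule hqp
  not_meetsSyzygy r hr := h.not_meetsSyzygy_store hpT hpR hqp hr
  rule_processed r hr := by
    rcases mem_replaceRule hr with rfl | ⟨hr, hrp⟩
    · exact .inl (.inl rfl)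
    · exact (h.rule_processed r hr).imp .inr fun hT => .inl ⟨hT, fun h_eq => hrp (by simp_all)⟩
  done_subset := by
    refine Set.forall_mem_insert.2 ⟨mem_replaceRule_self hpR, fun a ha => ?_⟩
    refine mem_replaceRule_of_ne (h.done_subset a ha) ?_
    rintro rfl
    exact h.notMem_done_of_sig_eq hpT hpR rfl ha
  done_homogeneous := Set.forall_mem_insert.2 ⟨hq_hom, h.done_homogeneous⟩
  done_irreducible := Set.forall_mem_insert.2 ⟨hq, h.done_irreducible⟩
  initial_processed i := by
    have exists_iff (s : WithBot (Sig ord d)) :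
        (∃ r ∈ replaceRule R p q, sig ord r = s) ↔ ∃ r ∈ R, sig ord r = s := by
      rw [← List.mem_map, map_sig_replaceRule hqp, List.mem_map]
    rw [exists_iff]
    by_cases hip : initialPair f i = p
    · exact .inr (.inr ⟨p, hpR, hip ▸ sig_initialPair i⟩)
    · exact (h.initial_processed i).imp_left fun hT => .inl ⟨hT, fun h_eq => hip (by simp_all)⟩
  jpair_processed _ ha _ hb _ hy := h.jpair_processed_store hpT hpR hqp ha hb hy

end Consistent

end Invariant

section Runs

variable {K : Type*} [Field K] {n d : ℕ} {ord : MonomialOrder (Fin n)}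
  {f : Fin d → MvPolynomial (Fin n) K} {k : Fin d → ℕ} {S S' : State f} {p q : Pair f}
  {x y : MPair f}

/-- The selected multiplied pair that is being processed, if any. -/
def Phase.current : Phase f → Set (MPair f)
  | .idle => ∅
  | .selected x => {x}
  | .reducing x _ => {x}

/-- The multiplied pairs whose processing is not yet finished. -/
def State.pending (S : State f) : Set (MPair f) := S.TODO ∪ S.phase.current

theorem State.pending_of_idle (hS : S.phase = .idle) : S.pending = S.TODO := by
  rw [State.pending, hS]
  exact Set.union_empty _

/-- The invariant of the runs of TRB-F5. -/
structure Invariant (ord : MonomialOrder (Fin n)) (k : Fin d → ℕ) (S : State f) : Prop where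
  consistent : Consistent ord k S.DONE S.pending S.Rules
  last_le : ∀ x, S.last = some x → ∀ y ∈ S.pending, sig ord (value x) ≤ sig ord (value y)
  current_last : ∀ x ∈ S.phase.current, S.last = some x
  current_notMem : ∀ x ∈ S.phase.current, x ∉ S.TODO
  current_rule : ∀ x ∈ S.phase.current, PassesF5 ord S.DONE S.Rules x → x.1 = 0 ∧ x.2 ∈ S.Rules
  reducing_passesF5 : ∀ x q, S.phase = .reducing x q → PassesF5 ord S.DONE S.Rules x
  reducing_sig : ∀ x q, S.phase = .reducing x q → sig ord q = sig ord (value x)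
  reducing_homogeneous : ∀ x q, S.phase = .reducing x q → ∃ E, IsHomogeneousPair k E q
  reducing_eq_or : ∀ x q, S.phase = .reducing x q → q = value x ∨ TopReducible ord (value x)

namespace Invariant

theorem of_idle (hS : S.phase = .idle) (hcons : Consistent ord k S.DONE S.TODO S.Rules)
    (hlast : ∀ x, S.last = some x → ∀ y ∈ S.TODO, sig ord (value x) ≤ sig ord (value y)) :
    Invariant ord k S := by
  constructor <;> simp_all [State.pending_of_idle hS, Phase.current]

theorem initial (hf : ∀ i, (f i).IsHomogeneous (k i)) : Invariant ord k (initialState f) :=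
  of_idle rfl (.initial hf) (by simp [initialState])

theorem rule (h : Invariant ord k S) (hS : S.phase = .idle) (hx : NeedsRule ord S x) :
    Invariant ord k { S with
      TODO := insert (0, value x) (S.TODO \ {x})
      Rules := value x :: S.Rules } := by
  obtain ⟨hcons, hlast, -⟩ := h
  rw [State.pending_of_idle hS] at hcons hlast
  obtain ⟨hxT, hmin, hpass, hxR⟩ := hx
  refine of_idle hS (hcons.prepend hxT (fun y hy => ?_) hpass hxR) fun z hz => ?_
  · rw [← not_lt, ← (hcons.isPending y hy).f5LT_iff (hcons.isPending x hxT).toIsCandidate]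
    exact hmin y hy
  · refine Set.forall_mem_insert.2 ⟨?_, fun y hy => hlast z hz y hy.1⟩
    rw [value_zero]
    exact hlast z hz x hxT

theorem select (hord : IsHomogeneousOrder ord) (h : Invariant ord k S) (hS : S.phase = .idle)
    (hrule : ∀ y, ¬ NeedsRule ord S y) (hx : x ∈ S.TODO)
    (hmin : ∀ y ∈ S.TODO, ¬ sig ord (value y) < sig ord (value x)) :
    Invariant ord k { S with
      TODO := S.TODO \ {x}
      last := some x
      phase := .selected x } := by
  have hcons := h.consistent
  rw [State.pending_of_idle hS] at hcons
  set S' : State f := { S with TODO := S.TODO \ {x}, last := some x, phase := .selected x }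
  have hpending : S'.pending = S.TODO := by
    rw [State.pending]
    exact Set.sdiff_union_of_subset (Set.singleton_subset_iff.2 hx)
  have hx_rule (hpass : PassesF5 ord S.DONE S.Rules x) : x.1 = 0 ∧ x.2 ∈ S.Rules := by
    by_contra hxR
    refine hrule x ⟨hx, fun y hy hlt => ?_, hpass, hxR⟩
    rw [(hcons.isPending y hy).f5LT_iff (hcons.isPending x hx).toIsCandidate] at hlt
    exact hlt.not_ge (sigGrade_monotone hord (not_lt.1 (hmin y hy)))
  constructor
  case consistent => rwa [hpending]
  case last_le =>
    rw [hpending]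
    rintro _ ⟨⟩ y hy
    exact not_lt.1 (hmin y hy)
  all_goals simp_all [S', Phase.current]

theorem pending_sdiff_of_current_eq (h : Invariant ord k S) (hS : S.phase.current = {x}) :
    S.pending \ {x} = S.TODO := by
  rw [State.pending, hS]
  exact Set.union_sdiff_cancel_right
    (Set.inter_singleton_eq_empty.2 (h.current_notMem x (hS ▸ rfl))).subset

theorem discard (h : Invariant ord k S) (hS : S.phase = .selected x)
    (hx : ¬ PassesF5 ord S.DONE S.Rules x) : Invariant ord k { S with phase := .idle } := by
  have hcons := h.consistent.erase hx
  rw [h.pending_sdiff_of_current_eq (by rw [hS]; rfl)] at hcons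
  exact of_idle rfl hcons fun z hz y hy => h.last_le z hz y (.inl hy)

theorem reducing (h : Invariant ord k S) (hS : S.phase.current = {x})
    (hx : PassesF5 ord S.DONE S.Rules x) (hq_sig : sig ord q = sig ord (value x))
    (hq_hom : ∃ E, IsHomogeneousPair k E q) (hq : q = value x ∨ TopReducible ord (value x)) :
    Invariant ord k { S with phase := .reducing x q } := by
  have hcurrent : (Phase.reducing x q).current = S.phase.current := hS.symm
  constructor
  case consistent =>
    rw [State.pending, hcurrent]
    exact h.consistent
  case last_le =>
    rw [State.pending, hcurrent]
    exact h.last_le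
  case current_last => exact hcurrent ▸ h.current_last
  case current_notMem => exact hcurrent ▸ h.current_notMem
  case current_rule => exact hcurrent ▸ h.current_rule
  all_goals
    rintro _ _ ⟨⟩
    assumption

theorem start (h : Invariant ord k S) (hS : S.phase = .selected x)
    (hx : PassesF5 ord S.DONE S.Rules x) :
    Invariant ord k { S with phase := .reducing x (value x) } :=
  h.reducing (by rw [hS]; rfl) hx rfl
    (h.consistent.isPending x (.inr (by rw [hS]; rfl))).homogeneous (.inl rfl)

theorem reduce (h : Invariant ord k S) (hS : S.phase = .reducing x q) (hy : y.2 ∈ S.DONE)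
    (hq : F5ReducibleBy ord S.DONE S.Rules q y) :
    Invariant ord k { S with phase := .reducing x (topReduct ord q y) } := by
  obtain ⟨E, hqE⟩ := h.reducing_homogeneous x q hS
  obtain ⟨E', hyE'⟩ := h.consistent.done_homogeneous _ hy
  refine h.reducing (by rw [hS]; rfl) (h.reducing_passesF5 x q hS)
    ((sig_topReduct hq.1).trans (h.reducing_sig x q hS)) ⟨E, hqE.topReduct hyE' hq.1⟩ (.inr ?_)
  rcases h.reducing_eq_or x q hS with rfl | hred
  · exact hq.1.topReducible
  · exact hred

theorem not_topReducible (h : Invariant ord k S) (hS : S.phase = .reducing x q)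
    (hq : ¬ F5Reducible ord S.DONE S.Rules q) : ¬ TopReducible ord q := fun hred =>
  hq <| CompleteUpTo.f5Reducible hred fun _ hs => h.consistent.completeUpTo fun y hy =>
    calc _ < sig ord (value x) := hs.trans_eq (h.reducing_sig x q hS)
      _ ≤ sig ord (value y) := h.last_le x (h.current_last x (by rw [hS]; rfl)) y hy

theorem not_blocked (h : Invariant ord k S) (hS : S.phase = .reducing x q)
    (hq : ¬ F5Reducible ord S.DONE S.Rules q) : ¬ Blocked ord (value x) q := by
  rintro ⟨hq_ne, hsig, hlm⟩
  have hirred := h.not_topReducible hS hq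
  have hequiv : Equivalent ord (value x) q := ⟨hsig.symm, hlm.symm⟩
  obtain rfl : q = value x :=
    (h.reducing_eq_or x q hS).resolve_right fun hred => hirred (hequiv.topReducible hred)
  have hx : x ∈ S.pending := .inr (by rw [hS]; rfl)
  exact hq_ne ((h.consistent.isPending x hx).exists_eq_initialPair hirred)

theorem store (hord : IsHomogeneousOrder ord) (h : Invariant ord k S)
    (hS : S.phase = .reducing x q) (hq : ¬ F5Reducible ord S.DONE S.Rules q) :
    Invariant ord k { S with
      DONE := insert q S.DONE
      TODO := S.TODO ∪ {y | ∃ p ∈ S.DONE, IsJPair ord q p y}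
      Rules := replaceRule S.Rules (value x) q
      phase := .idle } := by
  have hcurrent : S.phase.current = {x} := by rw [hS]; rfl
  have hx : x ∈ S.phase.current := hcurrent ▸ rfl
  have hirred := h.not_topReducible hS hq
  have hq_sig := h.reducing_sig x q hS
  have hx_le := h.last_le x (h.current_last x hx)
  have hpending := h.pending_sdiff_of_current_eq hcurrent
  obtain ⟨m, p⟩ := x
  obtain ⟨rfl : m = 0, hpR⟩ := h.current_rule _ hx (h.reducing_passesF5 _ q hS)
  rw [value_zero] at hq_sig hx_le ⊢
  have hcons := h.consistent.store hord (.inr hx) hpR hx_le hq_sig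
    (h.reducing_homogeneous _ q hS) hirred
  rw [hpending] at hcons
  refine of_idle rfl hcons fun z hz y hy => ?_
  obtain rfl : (0, p) = z := Option.some_injective _ ((h.current_last _ hx).symm.trans hz)
  rw [value_zero]
  rcases hy with hy | ⟨r, hr, hy⟩
  · exact hx_le y (.inl hy)
  · exact hq_sig ▸ (hy.sig_left_lt hirred (h.consistent.done_irreducible r hr)).le

theorem step (hord : IsHomogeneousOrder ord) (h : Invariant ord k S) (hstep : Step ord S S') :
    Invariant ord k S' := by
  cases hstep with
  | rule x hS hx => exact h.rule hS hx
  | select x hS hrule hx hmin => exact h.select hord hS hrule hx hmin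
  | discard x hS hx => exact h.discard hS hx
  | start x hS hx => exact h.start hS hx
  | reduce x q y hS hy hq => exact h.reduce hS hy hq
  | store x q hS hq => exact h.store hord hS hq
  | block x q hS hq hb => exact absurd hb (h.not_blocked hS hq)

theorem completeUpTo (h : Invariant ord k S) (hp : Considered ord S p) :
    CompleteUpTo S.DONE S.Rules (sig ord p) := by
  obtain ⟨x, hx, hlt⟩ := hp
  exact h.consistent.completeUpTo fun y hy => hlt.trans_le (h.last_le x hx y hy)

theorem completeUpTo_of_terminal (h : Invariant ord k S) (hS : Terminal S)
    (s : WithBot (Sig ord d)) : CompleteUpTo S.DONE S.Rules s :=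
  h.consistent.completeUpTo fun y hy => by
    rw [State.pending_of_idle hS.1, hS.2] at hy
    exact hy.elim

end Invariant

theorem Reachable.exists_invariant (hord : IsHomogeneousOrder ord)
    (hf : ∀ i, ∃ k, (f i).IsHomogeneous k) (hS : Reachable ord S) : ∃ k, Invariant ord k S := by
  choose k hk using hf
  refine ⟨k, ?_⟩
  induction hS with
  | refl => exact .initial hk
  | tail _ hstep ih => exact ih.step hord hstep

end Runs

end TRBF5

theorem mainTheorem3 {K : Type*} [Field K] {n d : ℕ} (ord : MonomialOrder (Fin n))
    (hord : TRBF5.IsHomogeneousOrder ord) :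
    (∀ f : Fin d → MvPolynomial (Fin n) K, (∀ i, ∃ k, (f i).IsHomogeneous k) →
      ∀ S : TRBF5.State f, TRBF5.Reachable ord S →
        ∀ p : TRBF5.Pair f, ¬ TRBF5.IsSyzygy ord p → TRBF5.Considered ord S p →
          (TRBF5.TopReducible ord p → TRBF5.F5Reducible ord S.DONE S.Rules p) ∧
          (p ∈ S.Rules → p ∈ S.DONE) ∧
          (TRBF5.IsTRP ord p → ∃ x : TRBF5.MPair f, x.2 ∈ S.DONE ∧
            TRBF5.PassesF5 ord S.DONE S.Rules x ∧ TRBF5.Equivalent ord p (TRBF5.value x)) ∧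
          (TRBF5.IsTRB ord p → ∃ p₁ ∈ S.DONE, TRBF5.Equivalent ord p p₁)) ∧
    TRBF5.IsRegularTRB K d ord := by
  refine ⟨fun f hf S hS p _ hcons => ?_,
    fun f hf => ⟨fun S x q hS hphase hq => ?_, fun S hS hterm p hp => ?_⟩⟩ <;>
  obtain ⟨k, hinv⟩ := hS.exists_invariant hord hf
  · have hcomplete := hinv.completeUpTo hcons
    exact ⟨fun hp => TRBF5.CompleteUpTo.f5Reducible hp fun s hs => hcomplete.mono hs.le,
      fun hp => hcomplete.rules_subset p hp le_rfl,
      fun hp => hcomplete.exists_passesF5_of_isTRP hp,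
      hcomplete.exists_equivalent_of_isTRB hinv.consistent.done_irreducible⟩
  · exact hinv.not_topReducible hphase hq
  · exact (hinv.completeUpTo_of_terminal hterm _).exists_equivalent_of_isTRB
      hinv.consistent.done_irreducible hp
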